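/- Conventions. $D(A)$ is the set of finitely supported functions $p:A\to\mathbb R_{\ge 0}$ with $\sum_a p(a)=1$; $D$ is a monad on sets. A convex set is a $D$-algebra, and $\mathsf{CSet}$ is the category of convex sets and convex maps, i.e. maps preserving convex combinations. A map $f:A\times B\to Z$ is biconvex if $f(\sum_i\alpha_ia_i,\sum_j\beta_jb_j)=\sum_{i,j}\alpha_i\beta_jf(a_i,b_j)$. The tensor product $A\otimes B$ is the quotient of the free convex set $D(A\times B)$ by the smallest congruence of convex sets that identifies $(\sum_i\alpha_ia_i,\sum_j\beta_jb_j)$ with $\sum_{i,j}\alpha_i\beta_j(a_i,b_j)$; it makes $\mathsf{CSet}$ symmetric monoidal, with unit the one-point set $*$. Let $K$ be a simplicial abelian group and $X$ a simplicial set. $\mathsf{Bun}_K(X)$ is the groupoid of principal $K$-bundles $\pi_E:E\to X$ (simplicial sets $E$ with a free $K$-action and quotient map $\pi_E$) and $K$-equivariant maps over $X$. It is symmetric monoidal for $E\otimes_KF=(E\times_XF)/\big((x,y)\sim(kx,k^{-1}y)\big)$, with unit $K\times X$. Let $\mathrm{sDist}(\pi_E)$ be the set of simplicial maps $p:X\to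 D(E)$ such that $D(\pi_E)\circ p$ sends each simplex to the delta distribution on it; it is a convex set under simplexwise convex combinations, and it is functorial in $E$ by push-forward. For $p\in\mathrm{sDist}(\pi_E)$ and $q\in\mathrm{sDist}(\pi_F)$ let $\mu_{E,F}(p,q)\in\mathrm{sDist}(\pi_{E\otimes_KF})$ send a simplex $x$ to the push-forward of the distribution $(a,b)\mapsto p_x(a)q_x(b)$ on $E\times_XF$ along the quotient map to $E\otimes_KF$. A functor $\pi:\mathcal D\to\mathcal C$ is a discrete fibration if its fibres are discrete categories, every morphism of $\mathcal D$ is coCartesian, and every morphism $\pi(x)\to c$ of $\mathcal C$ lifts to a morphism of $\mathcal D$ with source $x$. A fibrewise convex structure on it consists of convex structures on the sets $\pi^{-1}(c)$ for all objects $c$ and on the sets $\pi^{-1}(f)$ for all morphisms $f$ of $\mathcal C$ such that the source maps, the target maps and the identity maps $\pi^{-1}(c)\to\pi^{-1}(\mathrm{id}_c)$ are convex. A fibrewise convex monoidal category over a symmetric monoidal category $\mathcal C$ is a symmetric monoidal category $\mathcal D$ with a strict symmetric monoidal functor $\pi:\mathcal D\to\mathcal C$ that is a discrete fibration and has a fibrewise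 convex structure for which all the maps $\otimes:\pi^{-1}(c)\times\pi^{-1}(d)\to\pi^{-1}(c\otimes d)$ are biconvex. A twisting function $\eta$ is a family of maps $\eta_n:X_n\to K_{n-1}$, $n\ge1$, with $d_0\eta x=\eta d_1x-\eta d_0x$, $d_i\eta x=\eta d_{i+1}x$ for $i>0$, $s_i\eta x=\eta s_{i+1}x$ for $i\ge 0$, and $\eta s_0x=0$. Under addition these form a commutative monoid $\mathrm{Twist}_K(X)$. The twisted product $\pi_\eta:K\times_\eta X\to X$ is the principal $K$-bundle whose $n$-simplices are the pairs in $K_n\times X_n$, with $d_0(k,x)=(d_0k+\eta x,d_0x)$ and all other faces and all degeneracies componentwise. Corollary (convex Grothendieck construction of $\mathrm{sDist}$). (1) The maps $\mu_{E,F}$ are the structure maps of a lax symmetric monoidal functor $\mathrm{sDist}:(\mathsf{Bun}_K(X),\otimes_K)\to(\mathsf{CSet},\otimes)$, whose unit map $*\to\mathrm{sDist}(K\times X\to X)$ picks out $x\mapsto\delta_{(0,x)}$. (2) Let $\int\mathrm{sDist}$ be its Grothendieck construction: objects are pairs $(E,p)$ with $E\in\mathsf{Bun}_K(X)$ and $p\in\mathrm{sDist}(\pi_E)$,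 and morphisms $(E,p)\to(F,q)$ are the morphisms $f:E\to F$ with $f_*p=q$. The projection $\int\mathrm{sDist}\to\mathsf{Bun}_K(X)$ is a fibrewise convex monoidal category over $\mathsf{Bun}_K(X)$ with tensor product $(E,p)\otimes(F,q)=(E\otimes_KF,\mu_{E,F}(p,q))$, with unit $(K\times X,\ x\mapsto\delta_{(0,x)})$, and with the fibre over $E$ being the convex set $\mathrm{sDist}(\pi_E)$. (3) The set $\coprod_{\eta\in\mathrm{Twist}_K(X)}\mathrm{sDist}(\pi_\eta)$ is a commutative monoid over $\mathrm{Twist}_K(X)$ with fibrewise biconvex multiplication. That is, the projection to $\mathrm{Twist}_K(X)$ is a homomorphism and the maps $\mathrm{sDist}(\pi_\eta)\times\mathrm{sDist}(\pi_\zeta)\to\mathrm{sDist}(\pi_{\eta+\zeta})$ are biconvex. The product of $p\in\mathrm{sDist}(\pi_\eta)$ and $q\in\mathrm{sDist}(\pi_\zeta)$ is the push-forward of $\mu(p,q)$ along $(K\times_\eta X)\otimes_K(K\times_\zeta X)\to K\times_{\eta+\zeta}X$, $[(k,x),(l,x)]\mapsto(k+l,x)$, and the unit is $x\mapsto\delta_{(0,x)}$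 in $\mathrm{sDist}(\pi_0)$. -/

import Mathlib

open CategoryTheory MonoidalCategory Convexity Opposite
open scoped NNReal

universe v₁ v₂ u₁ u₂ u

noncomputable section

namespace ConvexGC

/-! ### Distributions and convex sets -/

/-- The set `D(A)` of finitely supported probability distributions on `A`. -/
abbrev Dist (A : Type u₁) : Type u₁ := StdSimplex ℝ≥0 A

/-- The product distribution `(x, y) ↦ p x * q y`. -/
def prodDist {A : Type u₁} {B : Type u₂} (p : Dist A) (q : Dist B) : Dist (A × B) :=
  p.iConvexComb fun x => q.map (Prod.mk x)

theorem prodDist_iConvexComb {A : Type u₁} {B : Type u₂} {Z : Type u} [ConvexSpace ℝ≥0 Z]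
    (p : Dist A) (q : Dist B) (h : A × B → Z) :
    (prodDist p q).iConvexComb h = p.iConvexComb fun x => q.iConvexComb fun y => h (x, y) := by
  unfold prodDist
  rw [← iConvexComb_assoc]
  simp

theorem iConvexComb_single_eq_map {A : Type u₁} {B : Type u₂} (p : Dist A) (f : A → B) :
    p.iConvexComb (fun a => (StdSimplex.single (f a) : Dist B)) = p.map f := by
  have h := (StdSimplex.isAffineMap_map ℝ≥0 f).map_iConvexComb p StdSimplex.single
  have h' : p.iConvexComb (StdSimplex.single : A → Dist A) = p := by
    ext1
    simp [iConvexComb, Finsupp.mapDomain, Finsupp.sum_sum_index, add_smul]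
  rw [h'] at h
  rw [h]
  congr 1
  funext a
  simp

theorem prodDist_eq {A : Type u₁} {B : Type u₂} (p : Dist A) (q : Dist B) :
    prodDist p q = p.iConvexComb fun x => q.iConvexComb fun y => StdSimplex.single (x, y) := by
  simp only [prodDist, iConvexComb_single_eq_map]

theorem prodDist_weights {A : Type u₁} {B : Type u₂} (p : Dist A) (q : Dist B) (x : A) (y : B) :
    (prodDist p q).weights (x, y) = p.weights x * q.weights y := by
  classical
  have h : ∀ a : A, (q.weights.mapDomain (Prod.mk a)) (x, y) = if a = x then q.weights y else 0 := by
    intro a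
    split_ifs with hax
    · subst hax
      exact Finsupp.mapDomain_apply (Prod.mk_right_injective a) _ _
    · refine Finsupp.mapDomain_of_notMem_range _ _ ?_
      rintro ⟨b, hb⟩
      exact hax (congrArg Prod.fst hb)
  simp only [prodDist, iConvexComb, StdSimplex.weights_sConvexComb, StdSimplex.weights_map]
  rw [Finsupp.sum_mapDomain_index (by simp) (by intros; simp [add_smul])]
  simp only [Finsupp.sum, Finsupp.coe_finsetSum, Finset.sum_apply, Finsupp.smul_apply,
    StdSimplex.weights_map, h, smul_eq_mul, mul_ite, mul_zero]
  rw [Finset.sum_ite_eq']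
  split_ifs with hx
  · rfl
  · simp [Finsupp.notMem_support_iff.mp hx]

theorem prodDist_map {A B A' B' : Type*} (p : Dist A) (q : Dist B) (f : A → A') (g : B → B') :
    (prodDist p q).map (Prod.map f g) = prodDist (p.map f) (q.map g) := by
  rw [prodDist_eq, prodDist_eq, map_iConvexComb]
  simp only [iConvexComb_map]
  congr 1
  funext x
  simp only [Function.comp_apply, map_iConvexComb]
  congr 1
  funext y
  simp

@[simp]
theorem prodDist_single {A B : Type*} (x : A) (y : B) :
    prodDist (StdSimplex.single x) (StdSimplex.single y) = (StdSimplex.single (x, y) : Dist _) := by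
  simp [prodDist]

/-- A map of two variables between convex sets is biconvex if
`f (∑ i, αᵢ xᵢ) (∑ j, βⱼ yⱼ) = ∑ i j, αᵢ βⱼ f xᵢ yⱼ`. -/
def IsBiconvex {A : Type*} {B : Type*} {Z : Type*} [ConvexSpace ℝ≥0 A] [ConvexSpace ℝ≥0 B]
    [ConvexSpace ℝ≥0 Z] (f : A → B → Z) : Prop :=
  ∀ (p : Dist A) (q : Dist B),
    f p.sConvexComb q.sConvexComb = (prodDist p q).iConvexComb fun z => f z.1 z.2

section Quotient

variable {M : Type u} [ConvexSpace ℝ≥0 M] (r : M → M → Prop)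

/-- The convex closure of a relation: the smallest equivalence relation containing it which is
compatible with convex combinations. -/
inductive ConvexClosure : M → M → Prop where
  | base {x y : M} : r x y → ConvexClosure x y
  | refl (x : M) : ConvexClosure x x
  | symm {x y : M} : ConvexClosure x y → ConvexClosure y x
  | trans {x y z : M} : ConvexClosure x y → ConvexClosure y z → ConvexClosure x z
  | convex {ι : Type u} (w : Dist ι) (a b : ι → M) :
      (∀ i, ConvexClosure (a i) (b i)) → ConvexClosure (w.iConvexComb a) (w.iConvexComb b)

/-- The setoid of the convex closure. -/
def convexSetoid : Setoid M where
  r := ConvexClosure r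
  iseqv := ⟨.refl, .symm, .trans⟩

/-- The quotient of a convex set by the convex closure of a relation. -/
def ConvexQuotient : Type u := Quotient (convexSetoid r)

namespace ConvexQuotient

variable {r}

/-- The quotient map. -/
def mk (x : M) : ConvexQuotient r := Quotient.mk (convexSetoid r) x

/-- A chosen representative. -/
def out (x : ConvexQuotient r) : M := Quotient.out x

theorem mk_out (x : ConvexQuotient r) : mk (out x) = x := Quotient.out_eq x

theorem mk_eq {x y : M} : (mk x : ConvexQuotient r) = mk y ↔ ConvexClosure r x y :=
  Quotient.eq (r := convexSetoid r)

theorem mk_surjective : Function.Surjective (mk : M → ConvexQuotient r) := fun x => ⟨_, mk_out x⟩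

theorem mk_iConvexComb_congr {ι : Type u} (w : Dist ι) {a b : ι → M}
    (h : ∀ i, (mk (a i) : ConvexQuotient r) = mk (b i)) :
    (mk (w.iConvexComb a) : ConvexQuotient r) = mk (w.iConvexComb b) :=
  mk_eq.mpr (.convex w a b fun i => mk_eq.mp (h i))

instance : ConvexSpace ℝ≥0 (ConvexQuotient r) :=
  ConvexSpace.mk (fun W => mk (W.iConvexComb out)) (fun x => by simp [mk_out]) (fun f => by
    have h1 : f.sConvexComb.iConvexComb (out : ConvexQuotient r → M)
        = f.iConvexComb fun d => d.iConvexComb out := by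
      rw [← iConvexComb_id', iConvexComb_assoc]
    rw [h1, iConvexComb_map]
    exact mk_iConvexComb_congr f fun d => mk_out _)

theorem isAffineMap_mk : IsAffineMap ℝ≥0 (mk : M → ConvexQuotient r) where
  map_sConvexComb w := by
    change mk w.sConvexComb = mk ((w.map mk).iConvexComb out)
    rw [iConvexComb_map, ← iConvexComb_id']
    exact mk_iConvexComb_congr w fun x => (mk_out _).symm

theorem lift_aux {Z : Type*} [ConvexSpace ℝ≥0 Z] (f : M → Z) (hf : IsAffineMap ℝ≥0 f)
    (h : ∀ x y, r x y → f x = f y) {x y : M} (hxy : ConvexClosure r x y) : f x = f y := by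
  induction hxy with
  | base h' => exact h _ _ h'
  | refl => rfl
  | symm _ ih => exact ih.symm
  | trans _ _ ih ih' => exact ih.trans ih'
  | convex w a b _ ih =>
    rw [hf.map_iConvexComb, hf.map_iConvexComb]
    congr 1
    funext i
    exact ih i

/-- A convex map compatible with the relation descends to the quotient. -/
def lift {Z : Type*} [ConvexSpace ℝ≥0 Z] (f : M → Z) (hf : IsAffineMap ℝ≥0 f)
    (h : ∀ x y, r x y → f x = f y) : ConvexQuotient r → Z :=
  Quotient.lift f fun _ _ hxy => lift_aux f hf h hxy

theorem lift_mk {Z : Type*} [ConvexSpace ℝ≥0 Z] (f : M → Z) (hf : IsAffineMap ℝ≥0 f)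
    (h : ∀ x y, r x y → f x = f y) (x : M) : lift f hf h (mk x) = f x := rfl

theorem isAffineMap_lift {Z : Type*} [ConvexSpace ℝ≥0 Z] (f : M → Z) (hf : IsAffineMap ℝ≥0 f)
    (h : ∀ x y, r x y → f x = f y) : IsAffineMap ℝ≥0 (lift f hf h) where
  map_sConvexComb w := by
    change lift f hf h (mk (w.iConvexComb out)) = _
    rw [lift_mk, hf.map_iConvexComb]
    change _ = w.iConvexComb (lift f hf h)
    congr 1
    funext x
    conv_rhs => rw [← mk_out x]
    rfl

end ConvexQuotient

end Quotient

/-! ### The convex tensor product -/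

section Tensor

variable (A B : Type u) [ConvexSpace ℝ≥0 A] [ConvexSpace ℝ≥0 B]

/-- The relations `(∑ i, αᵢ xᵢ, ∑ j, βⱼ yⱼ) ∼ ∑ i j, αᵢ βⱼ (xᵢ, yⱼ)` on `D(A × B)`. -/
inductive TensorRel : Dist (A × B) → Dist (A × B) → Prop where
  | intro (p : Dist A) (q : Dist B) :
      TensorRel (StdSimplex.single (p.sConvexComb, q.sConvexComb)) (prodDist p q)

/-- The convex tensor product. -/
abbrev ConvexTensor : Type u := ConvexQuotient (TensorRel A B)

variable {A B}

/-- The pure tensor `x ⊗ y`. -/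
def tmul (x : A) (y : B) : ConvexTensor A B := ConvexQuotient.mk (StdSimplex.single (x, y))

theorem mk_eq_iConvexComb (d : Dist (A × B)) :
    (ConvexQuotient.mk d : ConvexTensor A B) = d.iConvexComb fun z => tmul z.1 z.2 := by
  have h := ConvexQuotient.isAffineMap_mk (r := TensorRel A B) |>.map_iConvexComb d
    (fun z => StdSimplex.single z)
  rw [iConvexComb_single_eq_map] at h
  simpa [Function.comp_def, tmul, show (fun z : A × B => z) = id from rfl] using h

theorem isBiconvex_tmul : IsBiconvex (tmul : A → B → ConvexTensor A B) := by
  intro p q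
  rw [← mk_eq_iConvexComb]
  exact ConvexQuotient.mk_eq.mpr (.base (.intro p q))

variable {Z : Type*} [ConvexSpace ℝ≥0 Z]

theorem IsBiconvex.comp_affine {W : Type*} [ConvexSpace ℝ≥0 W] {f : A → B → Z} (hf : IsBiconvex f)
    {g : Z → W} (hg : IsAffineMap ℝ≥0 g) : IsBiconvex fun x y => g (f x y) := by
  intro p q
  change g (f _ _) = _
  rw [hf p q, hg.map_iConvexComb]
  rfl

theorem IsBiconvex.left {f : A → B → Z} (hf : IsBiconvex f) (y : B) :
    IsAffineMap ℝ≥0 fun x => f x y where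
  map_sConvexComb p := by
    have h := hf p (StdSimplex.single y)
    rw [prodDist_iConvexComb] at h
    simpa [sConvexComb_map] using h

theorem IsBiconvex.right {f : A → B → Z} (hf : IsBiconvex f) (x : A) :
    IsAffineMap ℝ≥0 fun y => f x y where
  map_sConvexComb q := by
    have h := hf (StdSimplex.single x) q
    rw [prodDist_iConvexComb] at h
    simpa [sConvexComb_map] using h

theorem IsBiconvex.of_left_right {f : A → B → Z} (h₁ : ∀ y, IsAffineMap ℝ≥0 fun x => f x y)
    (h₂ : ∀ x, IsAffineMap ℝ≥0 fun y => f x y) : IsBiconvex f := by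
  intro p q
  rw [prodDist_iConvexComb, (h₁ _).map_sConvexComb, sConvexComb_map]
  congr 1
  funext x
  rw [(h₂ x).map_sConvexComb, sConvexComb_map]

/-- A biconvex map factors through the tensor product. -/
def tensorLift (f : A → B → Z) (hf : IsBiconvex f) : ConvexTensor A B → Z :=
  ConvexQuotient.lift (fun d => d.iConvexComb fun z => f z.1 z.2)
    ⟨fun w => by
      rw [← iConvexComb_id', ← iConvexComb_assoc]
      rfl⟩
    (by
      rintro _ _ ⟨p, q⟩
      simpa using hf p q)

@[simp]
theorem tensorLift_tmul (f : A → B → Z) (hf : IsBiconvex f) (x : A) (y : B) :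
    tensorLift f hf (tmul x y) = f x y := by
  simp [tensorLift, tmul, ConvexQuotient.lift_mk]

theorem isAffineMap_tensorLift (f : A → B → Z) (hf : IsBiconvex f) :
    IsAffineMap ℝ≥0 (tensorLift f hf) := ConvexQuotient.isAffineMap_lift _ _ _

theorem tensor_ext {f g : ConvexTensor A B → Z} (hf : IsAffineMap ℝ≥0 f)
    (hg : IsAffineMap ℝ≥0 g) (h : ∀ x y, f (tmul x y) = g (tmul x y)) : f = g := by
  funext t
  obtain ⟨d, rfl⟩ := ConvexQuotient.mk_surjective t
  rw [mk_eq_iConvexComb, hf.map_iConvexComb, hg.map_iConvexComb]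
  congr 1
  funext z
  exact h _ _

end Tensor

/-! ### The symmetric monoidal category of convex sets -/

/-- A convex set: an algebra over the monad `D`. -/
structure CSet : Type (u + 1) where
  carrier : Type u
  [convex : ConvexSpace ℝ≥0 carrier]

attribute [instance] CSet.convex

namespace CSet

/-- A morphism of convex sets: a map commuting with convex combinations. -/
@[ext]
structure Hom (A B : CSet.{u}) where
  toFun : A.carrier → B.carrier
  affine : IsAffineMap ℝ≥0 toFun

instance : Category CSet.{u} where
  Hom := Hom
  id _ := ⟨id, IsAffineMap.id⟩
  comp f g := ⟨g.toFun ∘ f.toFun, g.affine.comp f.affine⟩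

@[ext]
theorem hom_ext {A B : CSet.{u}} {f g : A ⟶ B} (h : ∀ x, f.toFun x = g.toFun x) : f = g :=
  Hom.ext (funext h)

@[simp]
theorem id_toFun {A : CSet.{u}} (x : A.carrier) : Hom.toFun (𝟙 A) x = x := rfl

@[simp]
theorem comp_toFun {A B C : CSet.{u}} (f : A ⟶ B) (g : B ⟶ C) (x : A.carrier) :
    (f ≫ g).toFun x = g.toFun (f.toFun x) := rfl

/-- The underlying set functor. -/
def forget : CSet.{u} ⥤ Type u where
  obj A := A.carrier
  map f := ↾f.toFun

/-- Tensor product of objects. -/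
def tensor (A B : CSet.{u}) : CSet.{u} := ⟨ConvexTensor A.carrier B.carrier⟩

/-- The pure tensor `x ⊗ y`. -/
def tmul {A B : CSet.{u}} (x : A.carrier) (y : B.carrier) : (tensor A B).carrier :=
  ConvexGC.tmul x y

theorem isBiconvex_tmul {A B : CSet.{u}} :
    IsBiconvex (tmul : A.carrier → B.carrier → (tensor A B).carrier) := ConvexGC.isBiconvex_tmul

/-- A biconvex map as a morphism out of the tensor product. -/
def lift {A B C : CSet.{u}} (f : A.carrier → B.carrier → C.carrier) (hf : IsBiconvex f) :
    tensor A B ⟶ C := ⟨tensorLift f hf, isAffineMap_tensorLift f hf⟩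

@[simp]
theorem lift_tmul {A B C : CSet.{u}} (f : A.carrier → B.carrier → C.carrier) (hf : IsBiconvex f)
    (x : A.carrier) (y : B.carrier) : (lift f hf).toFun (tmul x y) = f x y :=
  tensorLift_tmul f hf x y

theorem tensor_hom_ext {A B C : CSet.{u}} {f g : tensor A B ⟶ C}
    (h : ∀ x y, f.toFun (tmul x y) = g.toFun (tmul x y)) : f = g :=
  Hom.ext (tensor_ext f.affine g.affine h)

theorem tensor_fun_ext {A B : CSet.{u}} {Z : Type*} [ConvexSpace ℝ≥0 Z]
    {f g : (tensor A B).carrier → Z} (hf : IsAffineMap ℝ≥0 f) (hg : IsAffineMap ℝ≥0 g)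
    (h : ∀ x y, f (tmul x y) = g (tmul x y)) : f = g := tensor_ext hf hg h

theorem tensor_hom_ext₃ {A B C E : CSet.{u}} {f g : tensor (tensor A B) C ⟶ E}
    (h : ∀ x y z, f.toFun (tmul (tmul x y) z) = g.toFun (tmul (tmul x y) z)) : f = g :=
  tensor_hom_ext fun t z => congrFun (tensor_fun_ext (f.affine.comp (isBiconvex_tmul.left z))
    (g.affine.comp (isBiconvex_tmul.left z)) fun x y => h x y z) t

theorem tensor_hom_ext₃' {A B C E : CSet.{u}} {f g : tensor A (tensor B C) ⟶ E}
    (h : ∀ x y z, f.toFun (tmul x (tmul y z)) = g.toFun (tmul x (tmul y z))) : f = g :=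
  tensor_hom_ext fun x t => congrFun (tensor_fun_ext (f.affine.comp (isBiconvex_tmul.right x))
    (g.affine.comp (isBiconvex_tmul.right x)) fun y z => h x y z) t

theorem tensor_hom_ext₄ {A B C E F : CSet.{u}} {f g : tensor (tensor (tensor A B) C) E ⟶ F}
    (h : ∀ x y z w, f.toFun (tmul (tmul (tmul x y) z) w) =
      g.toFun (tmul (tmul (tmul x y) z) w)) : f = g := by
  refine tensor_hom_ext fun t w => ?_
  have := tensor_hom_ext₃
    (f := (⟨_, f.affine.comp (isBiconvex_tmul.left w)⟩ : tensor (tensor A B) C ⟶ F))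
    (g := ⟨_, g.affine.comp (isBiconvex_tmul.left w)⟩) (fun x y z => h x y z w)
  exact congrFun (congrArg Hom.toFun this) t

/-- Tensor product of morphisms. -/
def tensorMap {A B A' B' : CSet.{u}} (f : A ⟶ A') (g : B ⟶ B') : tensor A B ⟶ tensor A' B' :=
  lift (fun x y => tmul (f.toFun x) (g.toFun y))
    (.of_left_right (fun y => (isBiconvex_tmul.left (g.toFun y)).comp f.affine)
      (fun x => (isBiconvex_tmul.right (f.toFun x)).comp g.affine))

/-- The one-point convex set. -/
def one : CSet.{u} where
  carrier := PUnit
  convex := ConvexSpace.mk (fun _ => ⟨⟩) (fun _ => rfl) (fun _ => rfl)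

instance : Subsingleton one.carrier := inferInstanceAs (Subsingleton PUnit)

theorem isAffineMap_const {A : Type*} {B : Type*} [ConvexSpace ℝ≥0 A] [ConvexSpace ℝ≥0 B] (b : B) :
    IsAffineMap ℝ≥0 (fun _ : A => b) := IsAffineMap.const b

theorem biconvex_assoc {A B C : CSet.{u}} (z : C.carrier) :
    IsBiconvex fun (x : A.carrier) (y : B.carrier) => tmul x (tmul y z) :=
  .of_left_right (fun _ => isBiconvex_tmul.left _)
    fun x => (isBiconvex_tmul.right x).comp (isBiconvex_tmul.left z)

theorem biconvex_assoc' {A B C : CSet.{u}} (x : A.carrier) :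
    IsBiconvex fun (y : B.carrier) (z : C.carrier) => tmul (tmul x y) z :=
  .of_left_right (fun z => (isBiconvex_tmul.left z).comp (isBiconvex_tmul.right x))
    fun _ => isBiconvex_tmul.right _

theorem isAffineMap_iConvexComb {M N I : Type*} [ConvexSpace ℝ≥0 M] [ConvexSpace ℝ≥0 N]
    (w : Dist I) (f : I → M → N) (hf : ∀ i, IsAffineMap ℝ≥0 (f i)) :
    IsAffineMap ℝ≥0 fun m => w.iConvexComb fun i => f i m where
  map_sConvexComb s := by
    simp only [(hf _).map_sConvexComb, sConvexComb_map]
    rw [iConvexComb_comm]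

/-- The associator `(x ⊗ y) ⊗ z ↦ x ⊗ (y ⊗ z)`. -/
def assocHom (A B C : CSet.{u}) : tensor (tensor A B) C ⟶ tensor A (tensor B C) :=
  lift (fun t z => (lift _ (biconvex_assoc z)).toFun t)
    (.of_left_right (fun z => (lift _ (biconvex_assoc z)).affine) fun t => ⟨fun w => by
      rw [sConvexComb_map]
      refine congrFun (tensor_fun_ext (lift _ (biconvex_assoc _)).affine
        (isAffineMap_iConvexComb w (fun z => (lift _ (biconvex_assoc z)).toFun)
          fun z => (lift _ (biconvex_assoc z)).affine) fun x y => ?_) t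
      simp only [lift_tmul]
      exact ((isBiconvex_tmul.right x).comp (isBiconvex_tmul.right y)).map_sConvexComb w⟩)

/-- The inverse associator. -/
def assocInv (A B C : CSet.{u}) : tensor A (tensor B C) ⟶ tensor (tensor A B) C :=
  lift (fun x t => (lift _ (biconvex_assoc' x)).toFun t)
    (.of_left_right (fun t => ⟨fun w => by
      rw [sConvexComb_map]
      refine congrFun (tensor_fun_ext (lift _ (biconvex_assoc' _)).affine
        (isAffineMap_iConvexComb w (fun x => (lift _ (biconvex_assoc' x)).toFun)
          fun x => (lift _ (biconvex_assoc' x)).affine) fun y z => ?_) t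
      simp only [lift_tmul]
      exact ((isBiconvex_tmul.left z).comp (isBiconvex_tmul.left y)).map_sConvexComb w⟩)
      fun x => (lift _ (biconvex_assoc' x)).affine)

@[simp]
theorem tensorMap_tmul {A B A' B' : CSet.{u}} (f : A ⟶ A') (g : B ⟶ B') (x : A.carrier)
    (y : B.carrier) : (tensorMap f g).toFun (tmul x y) = tmul (f.toFun x) (g.toFun y) :=
  lift_tmul ..

@[simp]
theorem assocHom_tmul {A B C : CSet.{u}} (x : A.carrier) (y : B.carrier) (z : C.carrier) :
    (assocHom A B C).toFun (tmul (tmul x y) z) = tmul x (tmul y z) := by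
  simp [assocHom]

@[simp]
theorem assocInv_tmul {A B C : CSet.{u}} (x : A.carrier) (y : B.carrier) (z : C.carrier) :
    (assocInv A B C).toFun (tmul x (tmul y z)) = tmul (tmul x y) z := by
  simp [assocInv]

/-- The associator. -/
def assoc (A B C : CSet.{u}) : tensor (tensor A B) C ≅ tensor A (tensor B C) where
  hom := assocHom A B C
  inv := assocInv A B C
  hom_inv_id := tensor_hom_ext₃ fun x y z => by simp
  inv_hom_id := tensor_hom_ext₃' fun x y z => by simp

/-- The left unitor `1 ⊗ x ↦ x`. -/
def leftUnitor (A : CSet.{u}) : tensor one A ≅ A where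
  hom := lift (fun _ x => x) (.of_left_right (fun x => isAffineMap_const x) fun _ => IsAffineMap.id)
  inv := ⟨fun x => tmul (A := one) PUnit.unit x, isBiconvex_tmul.right _⟩
  hom_inv_id := tensor_hom_ext fun x y => by simp; rfl
  inv_hom_id := hom_ext fun x =>
    lift_tmul (A := one) (fun _ x => x)
      (.of_left_right (fun x => isAffineMap_const x) fun _ => IsAffineMap.id) PUnit.unit x

/-- The right unitor `x ⊗ 1 ↦ x`. -/
def rightUnitor (A : CSet.{u}) : tensor A one ≅ A where
  hom := lift (fun x _ => x) (.of_left_right (fun _ => IsAffineMap.id) fun x => isAffineMap_const x)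
  inv := ⟨fun x => tmul (B := one) x PUnit.unit, isBiconvex_tmul.left _⟩
  hom_inv_id := tensor_hom_ext fun x y => by simp; rfl
  inv_hom_id := hom_ext fun x =>
    lift_tmul (B := one) (fun x _ => x)
      (.of_left_right (fun _ => IsAffineMap.id) fun x => isAffineMap_const x) x PUnit.unit

/-- The braiding `x ⊗ y ↦ y ⊗ x`. -/
def braid (A B : CSet.{u}) : tensor A B ≅ tensor B A where
  hom := lift (fun x y => tmul y x)
    (.of_left_right (fun y => isBiconvex_tmul.right y) fun x => isBiconvex_tmul.left x)
  inv := lift (fun x y => tmul y x)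
    (.of_left_right (fun y => isBiconvex_tmul.right y) fun x => isBiconvex_tmul.left x)
  hom_inv_id := tensor_hom_ext fun x y => by simp
  inv_hom_id := tensor_hom_ext fun x y => by simp

@[simp] theorem assoc_hom (A B C : CSet.{u}) : (assoc A B C).hom = assocHom A B C := rfl
@[simp] theorem assoc_inv (A B C : CSet.{u}) : (assoc A B C).inv = assocInv A B C := rfl

@[simp] theorem leftUnitor_tmul (A : CSet.{u}) (a : one.carrier) (x : A.carrier) :
    (leftUnitor A).hom.toFun (tmul a x) = x := by simp [leftUnitor]

@[simp] theorem rightUnitor_tmul (A : CSet.{u}) (a : one.carrier) (x : A.carrier) :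
    (rightUnitor A).hom.toFun (tmul x a) = x := by simp [rightUnitor]

@[simp] theorem braid_tmul (A B : CSet.{u}) (x : A.carrier) (y : B.carrier) :
    (braid A B).hom.toFun (tmul x y) = tmul y x := by simp [braid]

instance : MonoidalCategoryStruct CSet.{u} where
  tensorObj := tensor
  tensorHom := tensorMap
  whiskerLeft A _ _ g := tensorMap (𝟙 A) g
  whiskerRight f B := tensorMap f (𝟙 B)
  tensorUnit := one
  associator := assoc
  leftUnitor := leftUnitor
  rightUnitor := rightUnitor

instance : MonoidalCategory CSet.{u} :=
  MonoidalCategory.ofTensorHom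
    (id_tensorHom_id := fun A B => tensor_hom_ext fun x y => tensorMap_tmul ..)
    (id_tensorHom := fun _ _ _ _ => rfl)
    (tensorHom_id := fun _ _ => rfl)
    (tensorHom_comp_tensorHom := fun f₁ f₂ g₁ g₂ => tensor_hom_ext fun x y => by
      change (tensorMap g₁ g₂).toFun ((tensorMap f₁ f₂).toFun (tmul x y)) =
        (tensorMap (f₁ ≫ g₁) (f₂ ≫ g₂)).toFun (tmul x y)
      simp)
    (associator_naturality := fun f₁ f₂ f₃ => tensor_hom_ext₃ fun x y z => by
      change (assocHom _ _ _).toFun ((tensorMap (tensorMap f₁ f₂) f₃).toFun (tmul (tmul x y) z)) =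
        (tensorMap f₁ (tensorMap f₂ f₃)).toFun ((assocHom _ _ _).toFun (tmul (tmul x y) z))
      simp)
    (leftUnitor_naturality := fun {A B} f => tensor_hom_ext fun x y => by
      change (leftUnitor B).hom.toFun ((tensorMap (𝟙 _) f).toFun (tmul x y)) =
        f.toFun ((leftUnitor A).hom.toFun (tmul x y))
      simp)
    (rightUnitor_naturality := fun {A B} f => tensor_hom_ext fun x y => by
      change (rightUnitor B).hom.toFun ((tensorMap f (𝟙 _)).toFun (tmul x y)) =
        f.toFun ((rightUnitor A).hom.toFun (tmul x y))
      simp)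
    (pentagon := fun A B C E => tensor_hom_ext₄ fun x y z w => by
      change (tensorMap (𝟙 A) (assocHom B C E)).toFun ((assocHom A (tensor B C) E).toFun
          ((tensorMap (assocHom A B C) (𝟙 E)).toFun (tmul (tmul (tmul x y) z) w))) =
        (assocHom A B (tensor C E)).toFun ((assocHom (tensor A B) C E).toFun
          (tmul (tmul (tmul x y) z) w))
      simp)
    (triangle := fun A B => tensor_hom_ext₃ fun x y z => by
      change (tensorMap (𝟙 A) (leftUnitor B).hom).toFun
          ((assocHom A one B).toFun (tmul (tmul x y) z)) =
        (tensorMap (rightUnitor A).hom (𝟙 B)).toFun (tmul (tmul x y) z)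
      simp)

instance : SymmetricCategory CSet.{u} where
  braiding := braid
  braiding_naturality_right A B C f := tensor_hom_ext fun x y => by
    change (braid A C).hom.toFun ((tensorMap (𝟙 A) f).toFun (tmul x y)) =
      (tensorMap f (𝟙 A)).toFun ((braid A B).hom.toFun (tmul x y))
    simp
  braiding_naturality_left f C := tensor_hom_ext fun x y => by
    change (braid _ C).hom.toFun ((tensorMap f (𝟙 C)).toFun (tmul x y)) =
      (tensorMap (𝟙 C) f).toFun ((braid _ C).hom.toFun (tmul x y))
    simp
  hexagon_forward A B C := tensor_hom_ext₃ fun x y z => by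
    change (assocHom B C A).toFun ((braid A (tensor B C)).hom.toFun ((assocHom A B C).toFun
        (tmul (tmul x y) z))) =
      (tensorMap (𝟙 B) (braid A C).hom).toFun ((assocHom B A C).toFun
        ((tensorMap (braid A B).hom (𝟙 C)).toFun (tmul (tmul x y) z)))
    simp
  hexagon_reverse A B C := tensor_hom_ext₃' fun x y z => by
    change (assocInv C A B).toFun ((braid (tensor A B) C).hom.toFun ((assocInv A B C).toFun
        (tmul x (tmul y z)))) =
      (tensorMap (braid A C).hom (𝟙 B)).toFun ((assocInv A C B).toFun
        ((tensorMap (𝟙 A) (braid B C).hom).toFun (tmul x (tmul y z))))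
    simp
  symmetry A B := (braid A B).hom_inv_id

end CSet

/-! ### Simplicial distributions -/

open Simplicial

/-- The functor `D : Set ⥤ Set`. -/
def distFunctor : Type u ⥤ Type u where
  obj A := Dist A
  map f := ↾(StdSimplex.map f : Dist _ → Dist _)
  map_id A := by refine ConcreteCategory.hom_ext _ _ fun p => ?_; exact StdSimplex.map_id p
  map_comp f g := by refine ConcreteCategory.hom_ext _ _ fun p => ?_; exact StdSimplex.map_comp p f g

/-- The functor `D` applied levelwise to simplicial sets. -/
def simplicialDist : SSet.{u} ⥤ SSet.{u} :=
  (SimplicialObject.whiskering (Type u) (Type u)).obj distFunctor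

/-- The map `δ : X ⟶ D(X)` sending a simplex to the delta distribution on it. -/
def dirac (X : SSet.{u}) : X ⟶ simplicialDist.obj X where
  app n := ↾(fun x => (StdSimplex.single x : Dist (X.obj n)))
  naturality m n θ := by
    refine ConcreteCategory.hom_ext _ _ fun x => ?_
    exact (StdSimplex.map_single x (X.map θ)).symm

/-- Simplicial distributions on `π : E ⟶ X`: maps `p : X ⟶ D(E)` with `D(π) ∘ p = δ`. -/
def SDist {E X : SSet.{u}} (π : E ⟶ X) : Type u :=
  { p : X ⟶ simplicialDist.obj E // p ≫ simplicialDist.map π = dirac X }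

namespace SDist

variable {E X : SSet.{u}} {π : E ⟶ X}

/-- The distribution on `n`-simplices of `E` attached to an `n`-simplex of `X`. -/
def eval (p : SDist π) {n : SimplexCategoryᵒᵖ} (x : X.obj n) : Dist (E.obj n) := p.1.app n x

theorem eval_map (p : SDist π) {m n : SimplexCategoryᵒᵖ} (θ : m ⟶ n) (x : X.obj m) :
    p.eval (X.map θ x) = (p.eval x).map (E.map θ) :=
  NatTrans.naturality_apply p.1 θ x

theorem map_eval (p : SDist π) {n : SimplexCategoryᵒᵖ} (x : X.obj n) :
    (p.eval x).map (π.app n) = StdSimplex.single x :=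
  types_congr_hom (congrArg (fun f => f.app n) p.2) x

@[ext]
theorem ext {p q : SDist π} (h : ∀ (n : SimplexCategoryᵒᵖ) (x : X.obj n), p.eval x = q.eval x) :
    p = q := by
  apply Subtype.ext
  refine SSet.hom_ext fun n => ConcreteCategory.hom_ext _ _ fun x => ?_
  exact h n x

/-- A simplicial distribution from its values. -/
def ofEval (p : ∀ n : SimplexCategoryᵒᵖ, X.obj n → Dist (E.obj n))
    (h₁ : ∀ {m n : SimplexCategoryᵒᵖ} (θ : m ⟶ n) (x : X.obj m),
      p n (X.map θ x) = (p m x).map (E.map θ))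
    (h₂ : ∀ (n : SimplexCategoryᵒᵖ) (x : X.obj n), (p n x).map (π.app n) = StdSimplex.single x) :
    SDist π :=
  ⟨{ app := fun n => ↾(p n)
     naturality := fun m n θ => by refine ConcreteCategory.hom_ext _ _ fun x => ?_; exact h₁ θ x }, by
    refine SSet.hom_ext fun n => ConcreteCategory.hom_ext _ _ fun x => ?_
    exact h₂ n x⟩

@[simp]
theorem ofEval_eval (p : ∀ n : SimplexCategoryᵒᵖ, X.obj n → Dist (E.obj n)) (h₁ h₂)
    {n : SimplexCategoryᵒᵖ} (x : X.obj n) : (ofEval (π := π) p h₁ h₂).eval x = p n x := rfl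

/-- Convex combinations of simplicial distributions are taken simplexwise. -/
instance : ConvexSpace ℝ≥0 (SDist π) :=
  ConvexSpace.mk
    (fun w => ofEval (fun _ x => w.iConvexComb fun p => p.eval x)
      (fun θ x => by
        rw [map_iConvexComb]
        congr 1
        funext p
        exact p.eval_map θ x)
      (fun n x => by
        rw [map_iConvexComb]
        simp only [Function.comp_def, map_eval, iConvexComb_const]))
    (fun p => by ext n x : 2; simp)
    (fun f => by
      ext n x : 2
      simp only [ofEval_eval, iConvexComb_map]
      rw [iConvexComb_assoc, iConvexComb_id'])

theorem sConvexComb_eval (w : Dist (SDist π)) {n : SimplexCategoryᵒᵖ} (x : X.obj n) :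
    w.sConvexComb.eval x = w.iConvexComb fun p => p.eval x := rfl

/-- Pushforward along a map over `X`. -/
def map {F : SSet.{u}} {ρ : F ⟶ X} (f : E ⟶ F) (hf : f ≫ ρ = π) (p : SDist π) : SDist ρ :=
  ⟨p.1 ≫ simplicialDist.map f, by
    rw [Category.assoc, ← Functor.map_comp, hf, p.2]⟩

theorem map_eval' {F : SSet.{u}} {ρ : F ⟶ X} (f : E ⟶ F) (hf : f ≫ ρ = π) (p : SDist π)
    {n : SimplexCategoryᵒᵖ} (x : X.obj n) : (map (ρ := ρ) f hf p).eval x = (p.eval x).map (f.app n) :=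
  rfl

theorem isAffineMap_map {F : SSet.{u}} {ρ : F ⟶ X} (f : E ⟶ F) (hf : f ≫ ρ = π) :
    IsAffineMap ℝ≥0 (map (ρ := ρ) f hf : SDist π → SDist ρ) where
  map_sConvexComb w := by
    ext n x : 2
    rw [map_eval', sConvexComb_eval, sConvexComb_eval, map_iConvexComb, iConvexComb_map]
    rfl

end SDist

/-! ### Principal bundles -/

/-- A principal `K`-bundle over `X`: a simplicial set with a free `K`-action and a map to `X` which
is the quotient map of the action. -/
structure Bun (K : SimplicialObject AddCommGrpCat.{u}) (X : SSet.{u}) : Type (u + 1) where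
  total : SSet.{u}
  [action : ∀ n : SimplexCategoryᵒᵖ, AddAction (K.obj n) (total.obj n)]
  map_vadd : ∀ {m n : SimplexCategoryᵒᵖ} (θ : m ⟶ n) (k : K.obj m) (e : total.obj m),
    total.map θ (k +ᵥ e) = K.map θ k +ᵥ total.map θ e
  proj : total ⟶ X
  free : ∀ {n : SimplexCategoryᵒᵖ} (k : K.obj n) (e : total.obj n), k +ᵥ e = e → k = 0
  proj_surjective : ∀ n : SimplexCategoryᵒᵖ, Function.Surjective (proj.app n)
  proj_eq_iff : ∀ {n : SimplexCategoryᵒᵖ} (e e' : total.obj n),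
    proj.app n e = proj.app n e' ↔ ∃ k : K.obj n, k +ᵥ e = e'

attribute [instance] Bun.action

namespace Bun

variable {K : SimplicialObject AddCommGrpCat.{u}} {X : SSet.{u}}

/-- The `n`-simplices of the total space. -/
abbrev pt (E : Bun K X) (n : SimplexCategoryᵒᵖ) : Type u := E.total.obj n

@[simp]
theorem proj_vadd (E : Bun K X) {n : SimplexCategoryᵒᵖ} (k : K.obj n) (e : E.pt n) :
    E.proj.app n (k +ᵥ e) = E.proj.app n e :=
  ((E.proj_eq_iff e (k +ᵥ e)).mpr ⟨k, rfl⟩).symm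

theorem proj_map (E : Bun K X) {m n : SimplexCategoryᵒᵖ} (θ : m ⟶ n) (e : E.pt m) :
    E.proj.app n (E.total.map θ e) = X.map θ (E.proj.app m e) :=
  NatTrans.naturality_apply E.proj θ e

/-- Morphisms of principal bundles: `K`-equivariant maps over `X`. -/
@[ext]
structure Hom (E F : Bun K X) where
  toMap : E.total ⟶ F.total
  equivariant : ∀ {n : SimplexCategoryᵒᵖ} (k : K.obj n) (e : E.pt n),
    toMap.app n (k +ᵥ e) = k +ᵥ toMap.app n e
  over_base : toMap ≫ F.proj = E.proj

instance : Category (Bun K X) where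
  Hom := Hom
  id E := ⟨𝟙 _, fun _ _ => rfl, Category.id_comp _⟩
  comp f g := ⟨f.toMap ≫ g.toMap, fun k e => by
      change g.toMap.app _ (f.toMap.app _ _) = _ +ᵥ g.toMap.app _ (f.toMap.app _ _)
      rw [f.equivariant, g.equivariant], by rw [Category.assoc, g.over_base, f.over_base]⟩

/-- The action of a morphism on simplices. -/
def ap {E F : Bun K X} (f : E ⟶ F) {n : SimplexCategoryᵒᵖ} (e : E.pt n) : F.pt n :=
  f.toMap.app n e

@[ext]
theorem hom_ext {E F : Bun K X} {f g : E ⟶ F}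
    (h : ∀ (n : SimplexCategoryᵒᵖ) (e : E.pt n), ap f e = ap g e) : f = g := by
  apply Hom.ext
  refine SSet.hom_ext fun n => ConcreteCategory.hom_ext _ _ fun e => ?_
  exact h n e

@[simp] theorem id_ap {E : Bun K X} {n : SimplexCategoryᵒᵖ} (e : E.pt n) : ap (𝟙 E) e = e := rfl

@[simp] theorem comp_ap {E F G : Bun K X} (f : E ⟶ F) (g : F ⟶ G) {n : SimplexCategoryᵒᵖ}
    (e : E.pt n) : ap (f ≫ g) e = ap g (ap f e) := rfl

@[simp] theorem ap_vadd {E F : Bun K X} (f : E ⟶ F) {n : SimplexCategoryᵒᵖ} (k : K.obj n)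
    (e : E.pt n) : ap f (k +ᵥ e) = k +ᵥ ap f e := f.equivariant k e

theorem ap_map {E F : Bun K X} (f : E ⟶ F) {m n : SimplexCategoryᵒᵖ} (θ : m ⟶ n)
    (e : E.pt m) : ap f (E.total.map θ e) = F.total.map θ (ap f e) :=
  NatTrans.naturality_apply f.toMap θ e

@[simp] theorem proj_ap {E F : Bun K X} (f : E ⟶ F) {n : SimplexCategoryᵒᵖ} (e : E.pt n) :
    F.proj.app n (ap f e) = E.proj.app n e :=
  types_congr_hom (congrArg (fun g => g.app n) f.over_base) e

/-- A morphism from its values on simplices. -/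
def homMk {E F : Bun K X} (f : ∀ n : SimplexCategoryᵒᵖ, E.pt n → F.pt n)
    (h₁ : ∀ {m n : SimplexCategoryᵒᵖ} (θ : m ⟶ n) (e : E.pt m),
      f n (E.total.map θ e) = F.total.map θ (f m e))
    (h₂ : ∀ {n : SimplexCategoryᵒᵖ} (k : K.obj n) (e : E.pt n), f n (k +ᵥ e) = k +ᵥ f n e)
    (h₃ : ∀ {n : SimplexCategoryᵒᵖ} (e : E.pt n), F.proj.app n (f n e) = E.proj.app n e) :
    E ⟶ F where
  toMap :=
    { app := fun n => ↾(f n)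
      naturality := fun m n θ => by refine ConcreteCategory.hom_ext _ _ fun e => ?_; exact h₁ θ e }
  equivariant := h₂
  over_base := by refine SSet.hom_ext fun n => ConcreteCategory.hom_ext _ _ fun e => ?_; exact h₃ e

@[simp] theorem homMk_ap {E F : Bun K X} (f : ∀ n : SimplexCategoryᵒᵖ, E.pt n → F.pt n) (h₁ h₂ h₃)
    {n : SimplexCategoryᵒᵖ} (e : E.pt n) : ap (homMk (F := F) f h₁ h₂ h₃) e = f n e := rfl

theorem vadd_left_injective (E : Bun K X) {n : SimplexCategoryᵒᵖ} {k l : K.obj n} {e : E.pt n}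
    (h : k +ᵥ e = l +ᵥ e) : k = l := by
  have := E.free (-l + k) e (by rw [add_vadd, h, neg_vadd_vadd])
  rwa [neg_add_eq_zero, eq_comm] at this

theorem ap_bijective {E F : Bun K X} (f : E ⟶ F) (n : SimplexCategoryᵒᵖ) :
    Function.Bijective (ap f : E.pt n → F.pt n) := by
  constructor
  · intro e e' h
    have h' := congrArg (F.proj.app n) h
    rw [proj_ap, proj_ap, E.proj_eq_iff] at h'
    obtain ⟨k, rfl⟩ := h'
    rw [ap_vadd] at h
    rw [F.free k _ h.symm, zero_vadd]
  · intro y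
    obtain ⟨e, he⟩ := E.proj_surjective n (F.proj.app n y)
    rw [← proj_ap f, F.proj_eq_iff] at he
    obtain ⟨k, rfl⟩ := he
    exact ⟨k +ᵥ e, ap_vadd f k e⟩

/-- The inverse of a morphism of principal bundles. -/
def inverse {E F : Bun K X} (f : E ⟶ F) : F ⟶ E :=
  homMk (fun n => (Equiv.ofBijective _ (ap_bijective f n)).symm)
    (fun {m n} θ e => by
      obtain ⟨e, rfl⟩ := (ap_bijective f m).2 e
      rw [← ap_map, Equiv.ofBijective_symm_apply_apply, Equiv.ofBijective_symm_apply_apply])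
    (fun {n} k e => by
      obtain ⟨e, rfl⟩ := (ap_bijective f n).2 e
      rw [← ap_vadd, Equiv.ofBijective_symm_apply_apply, Equiv.ofBijective_symm_apply_apply])
    (fun {n} e => by
      obtain ⟨e, rfl⟩ := (ap_bijective f n).2 e
      rw [Equiv.ofBijective_symm_apply_apply, proj_ap])

/-- `Bun K X` is a groupoid. -/
instance : Groupoid (Bun K X) where
  inv := inverse
  inv_comp f := by
    ext n e
    exact Equiv.ofBijective_apply_symm_apply _ (ap_bijective f n) e
  comp_inv f := by
    ext n e
    exact Equiv.ofBijective_symm_apply_apply _ (ap_bijective f n) e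

/-- A morphism of principal bundles as an isomorphism. -/
def isoOfHom {E F : Bun K X} (f : E ⟶ F) : E ≅ F where
  hom := f
  inv := Groupoid.inv f
  hom_inv_id := Groupoid.comp_inv f
  inv_hom_id := Groupoid.inv_comp f

/-! ### The tensor product of principal bundles -/

section Tensor

variable (E F : Bun K X)

/-- The `n`-simplices of `E ×_X F`. -/
abbrev FibPair (n : SimplexCategoryᵒᵖ) : Type u :=
  { z : E.pt n × F.pt n // E.proj.app n z.1 = F.proj.app n z.2 }

/-- The relation `(x, y) ∼ (k x, k⁻¹ y)`. -/
def tensorSetoid (n : SimplexCategoryᵒᵖ) : Setoid (FibPair E F n) where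
  r z w := ∃ k : K.obj n, w.1.1 = k +ᵥ z.1.1 ∧ w.1.2 = -k +ᵥ z.1.2
  iseqv :=
    { refl := fun z => ⟨0, by simp⟩
      symm := by
        rintro z w ⟨k, h₁, h₂⟩
        exact ⟨-k, by rw [h₁, neg_vadd_vadd], by rw [h₂, neg_neg, vadd_neg_vadd]⟩
      trans := by
        rintro z w v ⟨k, h₁, h₂⟩ ⟨l, h₃, h₄⟩
        exact ⟨l + k, by rw [h₃, h₁, add_vadd], by rw [h₄, h₂, neg_add, add_vadd]⟩ }

/-- The `n`-simplices of `E ⊗_K F`. -/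
def TensorPt (n : SimplexCategoryᵒᵖ) : Type u := _root_.Quotient (tensorSetoid E F n)

variable {E F}

/-- The class `[x, y]`. -/
def tmk {n : SimplexCategoryᵒᵖ} (x : E.pt n) (y : F.pt n)
    (h : E.proj.app n x = F.proj.app n y) : TensorPt E F n :=
  Quotient.mk (tensorSetoid E F n) ⟨(x, y), h⟩

theorem tmk_surj {n : SimplexCategoryᵒᵖ} (w : TensorPt E F n) : ∃ x y h, w = tmk x y h := by
  obtain ⟨⟨⟨x, y⟩, h⟩, rfl⟩ := Quotient.exists_rep w
  exact ⟨x, y, h, rfl⟩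

theorem tmk_eq_iff {n : SimplexCategoryᵒᵖ} {x x' : E.pt n} {y y' : F.pt n} {h h'} :
    (tmk x y h : TensorPt E F n) = tmk x' y' h' ↔
      ∃ k : K.obj n, x' = k +ᵥ x ∧ y' = -k +ᵥ y :=
  Quotient.eq (r := tensorSetoid E F n)

/-- The map out of `E ⊗_K F` determined by a balanced map. -/
def telim {T : Type*} {n : SimplexCategoryᵒᵖ}
    (b : ∀ (x : E.pt n) (y : F.pt n), E.proj.app n x = F.proj.app n y → T)
    (hb : ∀ (k : K.obj n) (x : E.pt n) (y : F.pt n) (h h'), b (k +ᵥ x) (-k +ᵥ y) h' = b x y h) :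
    TensorPt E F n → T :=
  Quotient.lift (fun z => b z.1.1 z.1.2 z.2) (by
    rintro ⟨⟨x, y⟩, h⟩ ⟨⟨x', y'⟩, h'⟩ ⟨k, h₁, h₂⟩
    dsimp only at h₁ h₂
    subst h₁ h₂
    exact (hb k x y h h').symm)

@[simp]
theorem telim_tmk {T : Type*} {n : SimplexCategoryᵒᵖ}
    (b : ∀ (x : E.pt n) (y : F.pt n), E.proj.app n x = F.proj.app n y → T) (hb)
    (x : E.pt n) (y : F.pt n) (h) : telim b hb (tmk x y h) = b x y h := rfl

variable (E F)

/-- The simplicial set `E ⊗_K F`. -/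
def tensorTotal : SSet.{u} where
  obj n := TensorPt E F n
  map {m n} θ := ↾(telim (fun x y h => tmk (E.total.map θ x) (F.total.map θ y)
      (by rw [proj_map, proj_map, h]))
    (fun k x y h h' => (tmk_eq_iff.mpr ⟨K.map θ k, E.map_vadd θ k x, by
      rw [F.map_vadd, map_neg]⟩).symm))
  map_id n := by
    refine ConcreteCategory.hom_ext _ _ fun w => ?_
    obtain ⟨x, y, h, rfl⟩ := tmk_surj w
    simp
  map_comp θ ψ := by
    refine ConcreteCategory.hom_ext _ _ fun w => ?_
    obtain ⟨x, y, h, rfl⟩ := tmk_surj w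
    simp

theorem tensorTotal_map {m n : SimplexCategoryᵒᵖ} (θ : m ⟶ n) (x : E.pt m) (y : F.pt m) (h) :
    (tensorTotal E F).map θ (tmk x y h) = tmk (E.total.map θ x) (F.total.map θ y)
      (by rw [proj_map, proj_map, h]) := rfl

/-- `K` acts on `E ⊗_K F` by `k [x, y] = [k x, y]`. -/
instance tensorAction (n : SimplexCategoryᵒᵖ) : AddAction (K.obj n) (TensorPt E F n) where
  vadd k := telim (fun x y h => tmk (k +ᵥ x) y (by simpa using h))
    (fun l x y h h' => (tmk_eq_iff.mpr ⟨l, by rw [vadd_comm], rfl⟩).symm)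
  zero_vadd w := by
    obtain ⟨x, y, h, rfl⟩ := tmk_surj w
    exact tmk_eq_iff.mpr ⟨0, by simp⟩
  add_vadd k l w := by
    obtain ⟨x, y, h, rfl⟩ := tmk_surj w
    exact tmk_eq_iff.mpr ⟨0, by simp [add_vadd]⟩

variable {E F}

theorem vadd_tmk {n : SimplexCategoryᵒᵖ} (k : K.obj n) (x : E.pt n) (y : F.pt n) (h) :
    k +ᵥ (tmk x y h : TensorPt E F n) = tmk (k +ᵥ x) y (by simpa using h) := rfl

theorem vadd_tmk' {n : SimplexCategoryᵒᵖ} (k : K.obj n) (x : E.pt n) (y : F.pt n) (h) :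
    k +ᵥ (tmk x y h : TensorPt E F n) = tmk x (k +ᵥ y) (by simpa using h) :=
  tmk_eq_iff.mpr ⟨-k, by simp⟩

variable (E F)

/-- The projection `[x, y] ↦ π x`. -/
def tensorProj : tensorTotal E F ⟶ X where
  app n := ↾(telim (fun x _ _ => E.proj.app n x) (fun k x y h h' => E.proj_vadd k x))
  naturality m n θ := by
    refine ConcreteCategory.hom_ext _ _ fun w => ?_
    obtain ⟨x, y, h, rfl⟩ := tmk_surj w
    exact E.proj_map θ x

@[simp]
theorem tensorProj_tmk {n : SimplexCategoryᵒᵖ} (x : E.pt n) (y : F.pt n) (h) :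
    (tensorProj E F).app n (tmk x y h) = E.proj.app n x := rfl

/-- The principal bundle `E ⊗_K F`. -/
def tensor : Bun K X where
  total := tensorTotal E F
  action n := tensorAction E F n
  map_vadd {m n} θ k w := by
    obtain ⟨x, y, h, rfl⟩ := tmk_surj w
    change tmk _ _ _ = tmk _ _ _
    congr 1
    exact E.map_vadd θ k x
  proj := tensorProj E F
  free {n} k w hw := by
    obtain ⟨x, y, h, rfl⟩ := tmk_surj w
    obtain ⟨l, h₁, h₂⟩ := tmk_eq_iff.mp hw
    have hl := F.free _ y h₂.symm
    rw [neg_eq_zero] at hl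
    subst hl
    rw [zero_vadd] at h₁
    exact E.free k x h₁.symm
  proj_surjective n x := by
    obtain ⟨e, rfl⟩ := E.proj_surjective n x
    obtain ⟨f, hf⟩ := F.proj_surjective n (E.proj.app n e)
    exact ⟨tmk e f hf.symm, rfl⟩
  proj_eq_iff {n} w w' := by
    obtain ⟨x, y, h, rfl⟩ := tmk_surj w
    obtain ⟨x', y', h', rfl⟩ := tmk_surj w'
    constructor
    · intro hxy
      change E.proj.app n x = E.proj.app n x' at hxy
      obtain ⟨k, rfl⟩ := (E.proj_eq_iff _ _).mp hxy
      obtain ⟨l, rfl⟩ := (F.proj_eq_iff y y').mp (by rw [← h, ← h', hxy])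
      refine ⟨k + l, tmk_eq_iff.mpr ⟨-l, ?_, by simp⟩⟩
      rw [← add_vadd]
      congr 1
      abel
    · rintro ⟨k, hk⟩
      rw [← hk]
      exact (E.proj_vadd k x).symm

end Tensor

section Monoidal

variable {E F G H : Bun K X}

/-- The class `[x, y]` as a simplex of `E ⊗_K F`. -/
def pair {n : SimplexCategoryᵒᵖ} (x : E.pt n) (y : F.pt n)
    (h : E.proj.app n x = F.proj.app n y) : (tensor E F).pt n := tmk x y h

theorem pair_surj {n : SimplexCategoryᵒᵖ} (w : (tensor E F).pt n) : ∃ x y h, w = pair x y h :=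
  tmk_surj w

theorem pair_eq_iff {n : SimplexCategoryᵒᵖ} {x x' : E.pt n} {y y' : F.pt n} {h h'} :
    (pair x y h : (tensor E F).pt n) = pair x' y' h' ↔
      ∃ k : K.obj n, x' = k +ᵥ x ∧ y' = -k +ᵥ y := tmk_eq_iff

theorem vadd_pair {n : SimplexCategoryᵒᵖ} (k : K.obj n) (x : E.pt n) (y : F.pt n) (h) :
    k +ᵥ (pair x y h : (tensor E F).pt n) = pair (k +ᵥ x) y (by simpa using h) := rfl

theorem vadd_pair' {n : SimplexCategoryᵒᵖ} (k : K.obj n) (x : E.pt n) (y : F.pt n) (h) :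
    k +ᵥ (pair x y h : (tensor E F).pt n) = pair x (k +ᵥ y) (by simpa using h) := vadd_tmk' k x y h

theorem pair_vadd {n : SimplexCategoryᵒᵖ} (k : K.obj n) (x : E.pt n) (y : F.pt n) (h h') :
    (pair (k +ᵥ x) (-k +ᵥ y) h' : (tensor E F).pt n) = pair x y h :=
  (pair_eq_iff.mpr ⟨k, rfl, rfl⟩).symm

@[simp]
theorem proj_pair {n : SimplexCategoryᵒᵖ} (x : E.pt n) (y : F.pt n) (h) :
    (tensor E F).proj.app n (pair x y h) = E.proj.app n x := rfl

theorem map_pair {m n : SimplexCategoryᵒᵖ} (θ : m ⟶ n) (x : E.pt m) (y : F.pt m) (h) :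
    (tensor E F).total.map θ (pair x y h) = pair (E.total.map θ x) (F.total.map θ y)
      (by rw [proj_map, proj_map, h]) := rfl

/-- A morphism out of `E ⊗_K F` from a family of balanced maps. -/
def tensorDesc (b : ∀ (n : SimplexCategoryᵒᵖ) (x : E.pt n) (y : F.pt n),
      E.proj.app n x = F.proj.app n y → G.pt n)
    (h₀ : ∀ {n : SimplexCategoryᵒᵖ} (k : K.obj n) (x : E.pt n) (y : F.pt n) (h h'),
      b n (k +ᵥ x) (-k +ᵥ y) h' = b n x y h)
    (h₁ : ∀ {m n : SimplexCategoryᵒᵖ} (θ : m ⟶ n) (x : E.pt m) (y : F.pt m) (h h'),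
      b n (E.total.map θ x) (F.total.map θ y) h' = G.total.map θ (b m x y h))
    (h₂ : ∀ {n : SimplexCategoryᵒᵖ} (k : K.obj n) (x : E.pt n) (y : F.pt n) (h h'),
      b n (k +ᵥ x) y h' = k +ᵥ b n x y h)
    (h₃ : ∀ {n : SimplexCategoryᵒᵖ} (x : E.pt n) (y : F.pt n) (h),
      G.proj.app n (b n x y h) = E.proj.app n x) : tensor E F ⟶ G :=
  homMk (fun n => telim (b n) (h₀ (n := n)))
    (fun θ w => by
      obtain ⟨x, y, h, rfl⟩ := pair_surj w
      exact h₁ θ x y h _)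
    (fun k w => by
      obtain ⟨x, y, h, rfl⟩ := pair_surj w
      exact h₂ k x y h _)
    (fun w => by
      obtain ⟨x, y, h, rfl⟩ := pair_surj w
      exact h₃ x y h)

@[simp]
theorem tensorDesc_pair (b : ∀ (n : SimplexCategoryᵒᵖ) (x : E.pt n) (y : F.pt n),
      E.proj.app n x = F.proj.app n y → G.pt n) (h₀ h₁ h₂ h₃) {n : SimplexCategoryᵒᵖ}
    (x : E.pt n) (y : F.pt n) (h) : ap (tensorDesc b h₀ h₁ h₂ h₃) (pair x y h) = b n x y h := rfl

/-- Two morphisms out of `E ⊗_K F` agree if they agree on classes of pairs. -/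
theorem tensor_hom_ext {f g : tensor E F ⟶ G}
    (w : ∀ (n : SimplexCategoryᵒᵖ) (x : E.pt n) (y : F.pt n) (h), ap f (pair x y h) =
      ap g (pair x y h)) : f = g := by
  ext n e
  obtain ⟨x, y, h, rfl⟩ := pair_surj e
  exact w n x y h

/-- `f ⊗ g` sends `[x, y]` to `[f x, g y]`. -/
def tensorMap {E' F' : Bun K X} (f : E ⟶ E') (g : F ⟶ F') : tensor E F ⟶ tensor E' F' :=
  tensorDesc (fun _ x y h => pair (ap f x) (ap g y) (by simpa using h))
    (fun k x y h h' => by simp only [ap_vadd]; exact pair_vadd _ _ _ _ _)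
    (fun θ x y h h' => by simp only [ap_map]; rfl)
    (fun k x y h h' => by simp only [ap_vadd]; rfl)
    (fun x y h => by simp)

@[simp]
theorem tensorMap_pair {E' F' : Bun K X} (f : E ⟶ E') (g : F ⟶ F') {n : SimplexCategoryᵒᵖ}
    (x : E.pt n) (y : F.pt n) (h) :
    ap (tensorMap f g) (pair x y h) = pair (ap f x) (ap g y) (by simpa using h) := rfl

/-- Auxiliary function for the associator. -/
def assocFun {n : SimplexCategoryᵒᵖ} (w : (tensor E F).pt n) (z : G.pt n)
    (h : (tensor E F).proj.app n w = G.proj.app n z) : (tensor E (tensor F G)).pt n :=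
  pair (pair_surj w).choose
    (pair (pair_surj w).choose_spec.choose z (by
      rw [← h]
      conv_rhs => rw [(pair_surj w).choose_spec.choose_spec.choose_spec]
      exact (pair_surj w).choose_spec.choose_spec.choose.symm))
    (pair_surj w).choose_spec.choose_spec.choose

theorem assocFun_pair {n : SimplexCategoryᵒᵖ} (x : E.pt n) (y : F.pt n) (z : G.pt n) (h h') :
    assocFun (pair x y h) z h' = pair x (pair y z (h.symm.trans h')) h := by
  obtain ⟨k, h₁, h₂⟩ :=
    pair_eq_iff.mp (pair_surj (pair x y h)).choose_spec.choose_spec.choose_spec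
  exact (pair_eq_iff.mpr ⟨k, h₁, by rw [vadd_pair]; congr 1⟩).symm

/-- The associator `[[x, y], z] ↦ [x, [y, z]]`. -/
def assocHom (E F G : Bun K X) : tensor (tensor E F) G ⟶ tensor E (tensor F G) :=
  tensorDesc (fun _ w z h => assocFun w z h)
    (fun k w z h h' => by
      obtain ⟨x, y, h'', rfl⟩ := pair_surj w
      refine (assocFun_pair (k +ᵥ x) y (-k +ᵥ z) (by simpa using h'') h').trans ?_
      refine Eq.trans ?_ (assocFun_pair x y z h'' h).symm
      exact (pair_eq_iff.mpr ⟨k, rfl, (vadd_pair' _ _ _ _).symm⟩).symm)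
    (fun θ w z h h' => by
      obtain ⟨x, y, h'', rfl⟩ := pair_surj w
      simp only [map_pair, assocFun_pair]
      rfl)
    (fun k w z h h' => by
      obtain ⟨x, y, h'', rfl⟩ := pair_surj w
      simp only [vadd_pair, assocFun_pair]
      rfl)
    (fun w z h => by
      obtain ⟨x, y, h'', rfl⟩ := pair_surj w
      simp only [assocFun_pair]
      rfl)

@[simp]
theorem assocHom_pair {n : SimplexCategoryᵒᵖ} (x : E.pt n) (y : F.pt n) (z : G.pt n) (h h') :
    ap (assocHom E F G) (pair (pair x y h) z h') = pair x (pair y z (h.symm.trans h')) h :=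
  assocFun_pair x y z h h'

theorem inv_ap_ap (f : E ⟶ F) {n : SimplexCategoryᵒᵖ} (e : E.pt n) :
    ap (Groupoid.inv f) (ap f e) = e := by
  rw [← comp_ap, Groupoid.comp_inv, id_ap]

theorem inv_assocHom_pair {n : SimplexCategoryᵒᵖ} (x : E.pt n) (y : F.pt n) (z : G.pt n) (h h') :
    ap (Groupoid.inv (assocHom E F G)) (pair x (pair y z h) h') =
      pair (pair x y h') z (h'.trans h) :=
  (congrArg _ (assocHom_pair x y z h' (h'.trans h)).symm).trans (inv_ap_ap _ _)

/-- The braiding `[x, y] ↦ [y, x]`. -/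
def braidHom (E F : Bun K X) : tensor E F ⟶ tensor F E :=
  tensorDesc (fun _ x y h => pair y x h.symm)
    (fun k x y h h' => (pair_eq_iff.mpr ⟨-k, rfl, by simp⟩).symm)
    (fun θ x y h h' => rfl)
    (fun k x y h h' => by rw [vadd_pair'])
    (fun x y h => by simp [h])

@[simp]
theorem braidHom_pair {n : SimplexCategoryᵒᵖ} (x : E.pt n) (y : F.pt n) (h) :
    ap (braidHom E F) (pair x y h) = pair y x h.symm := rfl

variable (K X) in
/-- The `n`-simplices of `K × X`. -/
def ProdPt (n : SimplexCategoryᵒᵖ) : Type u := K.obj n × X.obj n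

/-- `K` acts on `K × X` by translation of the first factor. -/
instance (n : SimplexCategoryᵒᵖ) : AddAction (K.obj n) (ProdPt K X n) where
  vadd k z := (k + z.1, z.2)
  zero_vadd _ := Prod.ext (zero_add _) rfl
  add_vadd _ _ _ := Prod.ext (add_assoc _ _ _) rfl

theorem vadd_mk {n : SimplexCategoryᵒᵖ} (k l : K.obj n) (x : X.obj n) :
    k +ᵥ (show ProdPt K X n from (l, x)) = (k + l, x) := rfl

variable (K X) in
/-- The simplicial set `K × X`. -/
def trivialTotal : SSet.{u} where
  obj := ProdPt K X
  map {m n} θ := ↾(fun z : ProdPt K X m => ((K.map θ z.1, X.map θ z.2) : ProdPt K X n))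
  map_id n := by
    refine ConcreteCategory.hom_ext _ _ fun z => ?_
    refine Prod.ext ?_ ?_
    · change K.map (𝟙 n) z.1 = z.1
      simp
    · change X.map (𝟙 n) z.2 = z.2
      simp
  map_comp θ ψ := by
    refine ConcreteCategory.hom_ext _ _ fun z => ?_
    change ((K.map (θ ≫ ψ) z.1, X.map (θ ≫ ψ) z.2) : ProdPt K X _) =
      (K.map ψ (K.map θ z.1), X.map ψ (X.map θ z.2))
    simp

variable (K X) in
/-- The trivial principal bundle `K × X`. -/
def trivial : Bun K X where
  total := trivialTotal K X
  action n := (inferInstance : AddAction (K.obj n) (ProdPt K X n))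
  map_vadd θ k z := Prod.ext (map_add (K.map θ).hom _ _) rfl
  proj :=
    { app := fun n => ↾(fun z : ProdPt K X n => z.2)
      naturality := fun _ _ _ => rfl }
  free k z h := by
    have := congrArg Prod.fst h
    exact add_eq_right.mp this
  proj_surjective n x := ⟨(0, x), rfl⟩
  proj_eq_iff := by
    rintro n ⟨k, x⟩ ⟨l, y⟩
    constructor
    · intro h
      change x = y at h
      subst h
      exact ⟨l - k, Prod.ext (sub_add_cancel l k) rfl⟩
    · rintro ⟨k, hk⟩
      exact congrArg Prod.snd hk

/-- The left unitor `[(k, x), e] ↦ k e`. -/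
def leftUnitorHom (E : Bun K X) : tensor (trivial K X) E ⟶ E :=
  tensorDesc (fun n (z : ProdPt K X n) e _ => z.1 +ᵥ e)
    (fun {n} k (z : ProdPt K X n) e h h' => by
      change (k + z.1) +ᵥ -k +ᵥ e = z.1 +ᵥ e
      rw [← add_vadd]
      congr 1
      abel)
    (fun {m n} θ (z : ProdPt K X m) e h h' => (E.map_vadd θ z.1 e).symm)
    (fun {n} k (z : ProdPt K X n) e h h' => add_vadd k z.1 e)
    (fun {n} (z : ProdPt K X n) e h => (E.proj_vadd z.1 e).trans h.symm)

/-- The right unitor `[e, (k, x)] ↦ k e`. -/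
def rightUnitorHom (E : Bun K X) : tensor E (trivial K X) ⟶ E :=
  tensorDesc (fun n e (z : ProdPt K X n) _ => z.1 +ᵥ e)
    (fun {n} k e (z : ProdPt K X n) h h' => by
      change (-k + z.1) +ᵥ k +ᵥ e = z.1 +ᵥ e
      rw [← add_vadd]
      congr 1
      abel)
    (fun {m n} θ e (z : ProdPt K X m) h h' => (E.map_vadd θ z.1 e).symm)
    (fun {n} k e (z : ProdPt K X n) h h' => vadd_comm z.1 k e)
    (fun {n} e (z : ProdPt K X n) h => E.proj_vadd z.1 e)

theorem leftUnitorHom_pair {n : SimplexCategoryᵒᵖ} (k : K.obj n) (x : X.obj n) (e : E.pt n) (h) :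
    ap (leftUnitorHom E) (pair (E := trivial K X) (k, x) e h) = k +ᵥ e := rfl

theorem rightUnitorHom_pair {n : SimplexCategoryᵒᵖ} (k : K.obj n) (x : X.obj n) (e : E.pt n) (h) :
    ap (rightUnitorHom E) (pair (F := trivial K X) e (k, x) h) = k +ᵥ e := rfl

instance : MonoidalCategoryStruct (Bun K X) where
  tensorObj := tensor
  tensorHom := tensorMap
  whiskerLeft E _ _ g := tensorMap (𝟙 E) g
  whiskerRight f F := tensorMap f (𝟙 F)
  tensorUnit := trivial K X
  associator E F G := isoOfHom (assocHom E F G)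
  leftUnitor E := isoOfHom (leftUnitorHom E)
  rightUnitor E := isoOfHom (rightUnitorHom E)

/-- The monoidal structure `⊗_K`. -/
instance : MonoidalCategory (Bun K X) :=
  MonoidalCategory.ofTensorHom
    (id_tensorHom_id := fun E F => tensor_hom_ext fun n x y h => rfl)
    (id_tensorHom := fun _ _ _ _ => rfl)
    (tensorHom_id := fun _ _ => rfl)
    (tensorHom_comp_tensorHom := fun f₁ f₂ g₁ g₂ => tensor_hom_ext fun n x y h => rfl)
    (associator_naturality := fun {E₁ E₂ E₃ F₁ F₂ F₃} f₁ f₂ f₃ => tensor_hom_ext fun n w z h => by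
      obtain ⟨x, y, h', rfl⟩ := pair_surj w
      exact (assocHom_pair (ap f₁ x) (ap f₂ y) (ap f₃ z) (by simpa using h')
          (((proj_ap f₁ x).trans h).trans (proj_ap f₃ z).symm)).trans
        (congrArg (ap (tensorMap f₁ (tensorMap f₂ f₃))) (assocHom_pair x y z h' h)).symm)
    (leftUnitor_naturality := fun {E F} f => tensor_hom_ext fun n (z : ProdPt K X n) e h =>
      (ap_vadd f z.1 e).symm)
    (rightUnitor_naturality := fun {E F} f => tensor_hom_ext fun n e (z : ProdPt K X n) h =>
      (ap_vadd f z.1 e).symm)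
    (pentagon := fun E F G H => tensor_hom_ext fun n v w h => by
      obtain ⟨v, z, h', rfl⟩ := pair_surj v
      obtain ⟨x, y, h'', rfl⟩ := pair_surj v
      have h₁ : E.proj.app n x = F.proj.app n y := h''
      have h₂ : F.proj.app n y = G.proj.app n z := h''.symm.trans h'
      have h₃ : G.proj.app n z = H.proj.app n w := h'.symm.trans h
      have a₁ := assocHom_pair (pair x y h₁) z w (h₁.trans h₂) (h₁.trans (h₂.trans h₃))
      have a₂ := assocHom_pair x y (pair z w h₃) h₁ (h₁.trans h₂)
      have b₁ := assocHom_pair x y z h₁ (h₁.trans h₂)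
      have b₂ := assocHom_pair x (pair y z h₂) w h₁ (h₁.trans (h₂.trans h₃))
      have b₃ := assocHom_pair y z w h₂ (h₂.trans h₃)
      refine Eq.trans ?_ ((congrArg (ap (assocHom E F (tensor G H))) a₁).trans a₂).symm
      have c : ∀ (u : (tensor E (tensor F G)).pt n) (hu hu'),
          u = pair x (pair y z h₂) hu' → ap (tensorMap (𝟙 E) (assocHom F G H))
            (ap (assocHom E (tensor F G) H) (pair u w hu)) =
          pair x (pair y (pair z w h₃) h₂) h₁ := by
        rintro _ hu hu' rfl
        refine (congrArg (ap (tensorMap (𝟙 E) (assocHom F G H))) b₂).trans ?_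
        have d : ∀ (v : (tensor F (tensor G H)).pt n) (hv),
            v = pair y (pair z w h₃) h₂ → (pair x v hv : (tensor E _).pt n) =
              pair x (pair y (pair z w h₃) h₂) h₁ := by
          rintro _ _ rfl
          rfl
        exact d _ _ b₃
      exact c _ _ _ b₁)
    (triangle := fun E F => tensor_hom_ext fun n v f h => by
      obtain ⟨e, z, h', rfl⟩ := pair_surj v
      refine (congrArg (ap (tensorMap (𝟙 E) (leftUnitorHom F)))
        (assocHom_pair e z f h' h)).trans ?_
      obtain ⟨k, x⟩ := (z : ProdPt K X n)
      exact (vadd_pair' k e f (h'.trans (h'.symm.trans h))).symm)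

theorem hexagon (E F G : Bun K X) :
    assocHom E F G ≫ braidHom E (tensor F G) ≫ assocHom F G E =
      tensorMap (braidHom E F) (𝟙 G) ≫ assocHom F E G ≫ tensorMap (𝟙 F) (braidHom E G) :=
  tensor_hom_ext fun n v z h => by
    obtain ⟨x, y, h', rfl⟩ := pair_surj v
    have h₂ : F.proj.app n y = G.proj.app n z := h'.symm.trans h
    refine ((congrArg (fun u => ap (assocHom F G E) (ap (braidHom E (tensor F G)) u))
      (assocHom_pair x y z h' h)).trans (assocHom_pair y z x h₂ h'.symm)).trans ?_
    exact (congrArg (ap (tensorMap (𝟙 F) (braidHom E G)))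
      (assocHom_pair y x z h'.symm h₂)).symm

theorem braid_symm (E F : Bun K X) : braidHom E F ≫ braidHom F E = 𝟙 _ :=
  tensor_hom_ext fun _ _ _ _ => rfl

/-- The braiding as an isomorphism. -/
def braidIso (E F : Bun K X) : tensor E F ≅ tensor F E where
  hom := braidHom E F
  inv := braidHom F E
  hom_inv_id := braid_symm E F
  inv_hom_id := braid_symm F E

/-- The symmetric monoidal structure `⊗_K`. -/
instance : SymmetricCategory (Bun K X) where
  braiding := braidIso
  braiding_naturality_right E F G f := tensor_hom_ext fun n x y h => rfl
  braiding_naturality_left f G := tensor_hom_ext fun n x y h => rfl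
  hexagon_forward := hexagon
  hexagon_reverse E F G := by
    refine tensor_hom_ext fun n x w h => ?_
    obtain ⟨y, z, h', rfl⟩ := pair_surj w
    have h₁ : E.proj.app n x = F.proj.app n y := h
    refine ((congrArg (fun u => ap (Groupoid.inv (assocHom G E F)) (ap (braidHom (tensor E F) G) u))
      (inv_assocHom_pair x y z h' h)).trans
        (inv_assocHom_pair z x y h₁ (h₁.trans h').symm)).trans ?_
    exact (congrArg (ap (tensorMap (braidHom E G) (𝟙 F)))
      (inv_assocHom_pair x z y h'.symm (h₁.trans h'))).symm
  symmetry := braid_symm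

end Monoidal

end Bun

/-! ### The functor `sDist` and its multiplication -/

/-- A distribution on `M` which vanishes outside `s`, seen as a distribution on `s`. -/
def restrictTo {M : Type u₁} (s : M → Prop) (d : Dist M) (h : ∀ m, d.weights m ≠ 0 → s m) :
    Dist {m // s m} where
  weights := d.weights.subtypeDomain s
  nonneg := fun _ => zero_le
  total := by
    rw [← d.total]
    have := Finsupp.sum_subtypeDomain_index (v := d.weights) (p := s) (h := fun _ (r : ℝ≥0) => r)
      fun m hm => h m (Finsupp.mem_support_iff.mp hm)
    exact this

theorem restrictTo_map_val {M : Type u₁} (s : M → Prop) (d : Dist M)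
    (h : ∀ m, d.weights m ≠ 0 → s m) : (restrictTo s d h).map Subtype.val = d := by
  ext1
  rw [StdSimplex.weights_map]
  ext m
  by_cases hm : s m
  · have := Finsupp.mapDomain_apply (Subtype.val_injective (p := s)) (d.weights.subtypeDomain s)
      ⟨m, hm⟩
    exact congrArg NNReal.toReal this
  · rw [Finsupp.mapDomain_of_notMem_range]
    · by_contra hne
      exact hm (h m fun h0 => hne (by rw [h0]))
    · rintro ⟨⟨m, hm'⟩, rfl⟩
      exact hm hm'

variable {K : SimplicialObject AddCommGrpCat.{u}} {X : SSet.{u}}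

variable (K X) in
/-- The functor `sDist`. -/
def sDist : Bun K X ⥤ CSet.{u} where
  obj E := ⟨SDist E.proj⟩
  map f := ⟨SDist.map f.toMap f.over_base, SDist.isAffineMap_map f.toMap f.over_base⟩
  map_id _ := CSet.hom_ext fun p => SDist.ext fun _ x => StdSimplex.map_id (p.eval x)
  map_comp f g := CSet.hom_ext fun p => SDist.ext fun n x =>
    StdSimplex.map_comp (p.eval x) (f.toMap.app n) (g.toMap.app n)


theorem map_injective {M : Type*} {N : Type*} {f : M → N} (hf : Function.Injective f) :
    Function.Injective (StdSimplex.map f : Dist M → Dist N) := by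
  intro d e h
  ext1
  apply Finsupp.mapDomain_injective hf
  rw [← StdSimplex.weights_map, ← StdSimplex.weights_map, h]

namespace SDist

/-- `p x` is concentrated on the fibre of `x`. -/
theorem proj_eq_of_weights_ne_zero {E : SSet.{u}} {π : E ⟶ X} (p : SDist π)
    {n : SimplexCategoryᵒᵖ} (x : X.obj n) (e : E.obj n) (h : (p.eval x).weights e ≠ 0) :
    π.app n e = x := by
  classical
  by_contra hne
  have h₁ : ((p.eval x).map (π.app n)).weights (π.app n e) = 0 := by
    rw [p.map_eval]
    exact Finsupp.single_eq_of_ne hne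
  rw [StdSimplex.weights_map, Finsupp.mapDomain, Finsupp.sum, Finsupp.finsetSum_apply,
    Finset.sum_eq_zero_iff] at h₁
  have h₂ := h₁ e (Finsupp.mem_support_iff.mpr h)
  rw [Finsupp.single_eq_same] at h₂
  exact h h₂

end SDist

namespace Bun

variable {E F : Bun K X}

/-- The distribution `(a, b) ↦ p x a * q x b` on the `n`-simplices of `E ×_X F`. -/
def fibProd (p : SDist E.proj) (q : SDist F.proj) {n : SimplexCategoryᵒᵖ} (x : X.obj n) :
    Dist (FibPair E F n) :=
  restrictTo _ (prodDist (p.eval x) (q.eval x)) fun z hz => by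
    rw [prodDist_weights] at hz
    rw [p.proj_eq_of_weights_ne_zero x z.1 (left_ne_zero_of_mul hz),
      q.proj_eq_of_weights_ne_zero x z.2 (right_ne_zero_of_mul hz)]

theorem fibProd_map_val (p : SDist E.proj) (q : SDist F.proj) {n : SimplexCategoryᵒᵖ}
    (x : X.obj n) : (fibProd p q x).map Subtype.val = prodDist (p.eval x) (q.eval x) :=
  restrictTo_map_val _ _ _

/-- The map `μ_{E,F}`: the product distribution pushed forward along `E ×_X F → E ⊗_K F`. -/
def sDistMul (p : SDist E.proj) (q : SDist F.proj) : SDist (E ⊗ F).proj :=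
  SDist.ofEval (fun _ x => (fibProd p q x).map fun z => pair z.1.1 z.1.2 z.2)
    (fun {m n} θ x => by
      have h : fibProd p q (X.map θ x) = (fibProd p q x).map fun z =>
          ⟨(E.total.map θ z.1.1, F.total.map θ z.1.2), by
            rw [proj_map, proj_map, z.2]⟩ := by
        apply map_injective Subtype.val_injective
        rw [fibProd_map_val, StdSimplex.map_map, p.eval_map, q.eval_map, ← prodDist_map,
          ← fibProd_map_val, StdSimplex.map_map]
        rfl
      rw [h, StdSimplex.map_map, StdSimplex.map_map]
      rfl)
    (fun n x => by
      refine (StdSimplex.map_map _ _ _).trans ?_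
      have h : ((fibProd p q x).map Subtype.val).map
          (fun z : E.pt n × F.pt n => E.proj.app n z.1) = StdSimplex.single x := by
        rw [fibProd_map_val, prodDist_eq, map_iConvexComb]
        simp only [Function.comp_def, map_iConvexComb, StdSimplex.map_single, iConvexComb_const]
        rw [iConvexComb_single_eq_map]
        exact p.map_eval x
      exact (StdSimplex.map_map (fibProd p q x) Subtype.val _).symm.trans h)

/-- The point `(0, x)` of `K × X`. -/
def zeroPt {n : SimplexCategoryᵒᵖ} (x : X.obj n) : (𝟙_ (Bun K X)).pt n :=
  ((0, x) : ProdPt K X n)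

variable (K X) in
/-- The unit `x ↦ δ_{(0, x)}`, a simplicial distribution on the trivial bundle `K × X`. -/
def sDistUnit : SDist (𝟙_ (Bun K X)).proj :=
  SDist.ofEval (fun _ x => StdSimplex.single (zeroPt x))
    (fun {m n} θ x => by
      refine Eq.trans ?_ (StdSimplex.map_single _ _).symm
      congr 1
      exact Prod.ext (map_zero (K.map θ).hom).symm rfl)
    (fun n x => StdSimplex.map_single _ _)

end Bun

/-! ### Fibrewise convex monoidal categories -/

section Fibrations

variable {C : Type u₁} [Category.{v₁} C] {D : Type u₂} [Category.{v₂} D]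

/-- A discrete fibration: the fibres are discrete, every morphism is coCartesian, and every
morphism of the base with a chosen lift of its source has a lift. -/
structure IsDiscreteFibration (π : D ⥤ C) : Prop where
  discrete : ∀ c : C, IsDiscrete (π.Fiber c)
  coCartesian : ∀ {x y : D} (φ : x ⟶ y), π.IsStronglyCocartesian (π.map φ) φ
  exists_lift : ∀ (x : D) {c : C} (f : π.obj x ⟶ c), ∃ (y : D) (φ : x ⟶ y), π.IsHomLift f φ

/-- The fibre of `π` over a morphism `f`: the set of morphisms lying over `f`. -/
structure FibreHom (π : D ⥤ C) {c d : C} (f : c ⟶ d) where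
  source : π.Fiber c
  target : π.Fiber d
  hom : source.1 ⟶ target.1
  lift : π.IsHomLift f hom

/-- The identity of an object, as an element of the fibre over an identity. -/
def FibreHom.id (π : D ⥤ C) {c : C} (x : π.Fiber c) : FibreHom π (𝟙 c) :=
  ⟨x, x, 𝟙 x.1, IsHomLift.id x.2⟩

/-- A fibrewise convex structure: convex structures on the fibres over objects and morphisms for
which source, target and identities are convex. -/
structure FibrewiseConvexStructure (π : D ⥤ C) where
  obj : ∀ c : C, ConvexSpace ℝ≥0 (π.Fiber c)
  hom : ∀ {c d : C} (f : c ⟶ d), ConvexSpace ℝ≥0 (FibreHom π f)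
  source : ∀ {c d : C} (f : c ⟶ d),
    IsAffineMap ℝ≥0 (FibreHom.source : FibreHom π f → π.Fiber c)
  target : ∀ {c d : C} (f : c ⟶ d),
    IsAffineMap ℝ≥0 (FibreHom.target : FibreHom π f → π.Fiber d)
  identity : ∀ c : C, IsAffineMap ℝ≥0 (FibreHom.id π : π.Fiber c → FibreHom π (𝟙 c))

/-- A symmetric monoidal functor is strict if its structure morphisms are identities. -/
structure IsStrictMonoidal [MonoidalCategory C] [MonoidalCategory D] (π : D ⥤ C)
    [π.Monoidal] : Prop where
  obj_unit : π.obj (𝟙_ D) = 𝟙_ C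
  obj_tensor : ∀ x y : D, π.obj (x ⊗ y) = π.obj x ⊗ π.obj y
  ε_eq : Functor.LaxMonoidal.ε π = eqToHom obj_unit.symm
  μ_eq : ∀ x y : D, Functor.LaxMonoidal.μ π x y = eqToHom (obj_tensor x y).symm

/-- The map `π⁻¹(c) × π⁻¹(d) → π⁻¹(c ⊗ d)` given by the tensor product. -/
def fibreTensor [MonoidalCategory C] [MonoidalCategory D] {π : D ⥤ C}
    (h : ∀ x y : D, π.obj (x ⊗ y) = π.obj x ⊗ π.obj y) {c d : C} (x : π.Fiber c) (y : π.Fiber d) :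
    π.Fiber (c ⊗ d) :=
  ⟨x.1 ⊗ y.1, by rw [h, x.2, y.2]⟩

/-- The structure of a fibrewise convex (symmetric) monoidal category on `π : D ⥤ C`, where `C` is
symmetric monoidal: a symmetric monoidal structure on `D` for which `π` is strict symmetric
monoidal and a discrete fibration, together with a fibrewise convex structure for which the
tensor product is biconvex on fibres. -/
structure ConvexMonoidalFibration [MonoidalCategory C] [SymmetricCategory C] (π : D ⥤ C) where
  monoidal : MonoidalCategory D
  symmetric : SymmetricCategory D
  braided : π.Braided
  strict : IsStrictMonoidal π
  fibration : IsDiscreteFibration π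
  convex : FibrewiseConvexStructure π
  biconvex : ∀ c d : C,
    letI := convex.obj c
    letI := convex.obj d
    letI := convex.obj (c ⊗ d)
    IsBiconvex (fibreTensor strict.obj_tensor : π.Fiber c → π.Fiber d → π.Fiber (c ⊗ d))

/-- The functor `∫ F → C` from the Grothendieck construction of a functor to convex sets. -/
abbrev groth (F : C ⥤ CSet.{u}) : (F ⋙ CSet.forget).Elements ⥤ C :=
  CategoryOfElements.π (F ⋙ CSet.forget)

/-- The object `(c, x)` of `∫ F`. -/
def grothMk (F : C ⥤ CSet.{u}) (c : C) (x : (F.obj c).carrier) : (F ⋙ CSet.forget).Elements :=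
  ⟨c, x⟩

/-- The object `(c, x)` of `∫ F`, as an element of the fibre over `c`. -/
def grothFibreMk (F : C ⥤ CSet.{u}) (c : C) (x : (F.obj c).carrier) : (groth F).Fiber c :=
  ⟨grothMk F c x, rfl⟩

/-- The structure on `∫ F → C` is the one of the convex Grothendieck construction of the lax
monoidal functor `F`: `(c, x) ⊗ (d, y) = (c ⊗ d, μ (x ⊗ y))`, the unit is `(1, ε)`, and the fibre
over `c` is the convex set `F c`. (The remaining data, such as the tensor product of morphisms and
the convex structures on the fibres over morphisms, is determined by this.) -/
structure ConvexMonoidalFibration.IsInducedBy [MonoidalCategory C] [SymmetricCategory C]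
    {F : C ⥤ CSet.{u}} (S : ConvexMonoidalFibration (groth F)) (L : F.LaxMonoidal) : Prop where
  tensor : ∀ (c d : C) (x : (F.obj c).carrier) (y : (F.obj d).carrier),
    S.monoidal.tensorObj (grothMk F c x) (grothMk F d y) =
      grothMk F (c ⊗ d) ((L.μ c d).toFun (CSet.tmul x y))
  unit : S.monoidal.tensorUnit = grothMk F (𝟙_ C) (L.ε.toFun PUnit.unit)
  fibre : ∀ c : C,
    letI := S.convex.obj c
    IsAffineMap ℝ≥0 (grothFibreMk F c)

end Fibrations

/-! ### Twisting functions and twisted products -/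

/-- A twisting function: maps `η : X (n + 1) → K n` with
`d₀ η x = η (d₁ x) - η (d₀ x)`, `dᵢ η x = η (dᵢ₊₁ x)` for `i > 0`,
`sᵢ η x = η (sᵢ₊₁ x)` and `η (s₀ x) = 0`. -/
@[ext]
structure TwistingFunction (K : SimplicialObject AddCommGrpCat.{u}) (X : SSet.{u}) where
  toFun : ∀ n : ℕ, X.obj (op ⦋n + 1⦌) → K.obj (op ⦋n⦌)
  δ_zero : ∀ (n : ℕ) (x : X.obj (op ⦋n + 2⦌)),
    K.δ 0 (toFun (n + 1) x) = toFun n (X.δ 1 x) - toFun n (X.δ 0 x)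
  δ_succ : ∀ (n : ℕ) (i : Fin (n + 1)) (x : X.obj (op ⦋n + 2⦌)),
    K.δ i.succ (toFun (n + 1) x) = toFun n (X.δ i.succ.succ x)
  σ : ∀ (n : ℕ) (i : Fin (n + 1)) (x : X.obj (op ⦋n + 1⦌)),
    K.σ i (toFun n x) = toFun (n + 1) (X.σ i.succ x)
  σ_zero : ∀ (n : ℕ) (x : X.obj (op ⦋n⦌)), toFun n (X.σ 0 x) = 0

namespace TwistingFunction

variable (η ζ : TwistingFunction K X)

instance : Zero (TwistingFunction K X) where
  zero := ⟨fun _ _ => 0, by simp, by simp, by simp, by simp⟩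

instance : Add (TwistingFunction K X) where
  add η ζ :=
    { toFun := fun n x => η.toFun n x + ζ.toFun n x
      δ_zero := fun n x => by rw [map_add, η.δ_zero, ζ.δ_zero]; abel
      δ_succ := fun n i x => by rw [map_add, η.δ_succ, ζ.δ_succ]
      σ := fun n i x => by rw [map_add, η.σ, ζ.σ]
      σ_zero := fun n x => by rw [η.σ_zero, ζ.σ_zero, add_zero] }

variable {η ζ} in
theorem ext' (h : ∀ n x, η.toFun n x = ζ.toFun n x) : η = ζ :=
  TwistingFunction.ext (funext fun n => funext fun x => h n x)

@[simp] theorem zero_toFun (n : ℕ) (x : X.obj (op ⦋n + 1⦌)) :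
    (0 : TwistingFunction K X).toFun n x = 0 := rfl

@[simp] theorem add_toFun (n : ℕ) (x : X.obj (op ⦋n + 1⦌)) :
    (η + ζ).toFun n x = η.toFun n x + ζ.toFun n x := rfl

/-- Twisting functions form a commutative monoid under addition. -/
instance : AddCommMonoid (TwistingFunction K X) where
  add_assoc _ _ _ := ext' fun _ _ => add_assoc _ _ _
  zero_add _ := ext' fun _ _ => zero_add _
  add_zero _ := ext' fun _ _ => add_zero _
  add_comm _ _ := ext' fun _ _ => add_comm _ _
  nsmul := nsmulRec

/-- The map `θ⁺ : [m + 1] → [n]` with `θ⁺ 0 = 0` and `θ⁺ (i + 1) = θ i`. -/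
def extHom {a b : SimplexCategory} (θ : a ⟶ b) : ⦋a.len + 1⦌ ⟶ b :=
  SimplexCategory.Hom.mk
    ⟨Fin.cases 0 θ.toOrderHom, by
      intro i j h
      induction i using Fin.cases with
      | zero => exact Fin.zero_le _
      | succ i =>
        induction j using Fin.cases with
        | zero => exact absurd h (by simp)
        | succ j => exact θ.toOrderHom.monotone (Fin.succ_le_succ_iff.mp h)⟩

/-- The map `[m + 1] → [n + 1]` with `0 ↦ 0` and `i + 1 ↦ θ i + 1`. -/
def joinHom {a b : SimplexCategory} (θ : a ⟶ b) : ⦋a.len + 1⦌ ⟶ ⦋b.len + 1⦌ :=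
  SimplexCategory.Hom.mk
    ⟨Fin.cases 0 fun i => (θ.toOrderHom i).succ, by
      intro i j h
      induction i using Fin.cases with
      | zero => exact Fin.zero_le _
      | succ i =>
        induction j using Fin.cases with
        | zero => exact absurd h (by simp)
        | succ j =>
          have h' := θ.toOrderHom.monotone (Fin.succ_le_succ_iff.mp h)
          exact Fin.succ_le_succ_iff.mpr h'⟩

theorem hom_ext_cases {n : ℕ} {b : SimplexCategory} {f g : ⦋n + 1⦌ ⟶ b}
    (h₀ : f.toOrderHom 0 = g.toOrderHom 0)
    (h₁ : ∀ i : Fin (n + 1), f.toOrderHom i.succ = g.toOrderHom i.succ) : f = g :=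
  SimplexCategory.Hom.ext _ _ (OrderHom.ext _ _ (funext fun i => Fin.cases h₀ h₁ i))

theorem δ_zero_extHom {a b : SimplexCategory} (θ : a ⟶ b) :
    SimplexCategory.δ 0 ≫ extHom θ = θ :=
  SimplexCategory.Hom.ext _ _ (OrderHom.ext _ _ rfl)

theorem δ_zero_joinHom {a b : SimplexCategory} (θ : a ⟶ b) :
    SimplexCategory.δ 0 ≫ joinHom θ = θ ≫ SimplexCategory.δ 0 := rfl

theorem joinHom_extHom {a b c : SimplexCategory} (θ : a ⟶ b) (ψ : b ⟶ c) :
    joinHom θ ≫ extHom ψ = extHom (θ ≫ ψ) := hom_ext_cases rfl fun _ => rfl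

theorem joinHom_comp {a b c : SimplexCategory} (θ : a ⟶ b) (ψ : b ⟶ c) :
    joinHom (θ ≫ ψ) = joinHom θ ≫ joinHom ψ := hom_ext_cases rfl fun _ => rfl

theorem joinHom_id (a : SimplexCategory) : joinHom (𝟙 a) = 𝟙 _ := hom_ext_cases rfl fun _ => rfl

theorem extHom_id (a : SimplexCategory) : extHom (𝟙 a) = SimplexCategory.σ 0 :=
  hom_ext_cases rfl fun _ => rfl

theorem extHom_of_zero {a b : SimplexCategory} (θ : a ⟶ b) (h : θ.toOrderHom 0 = 0) :
    extHom θ = SimplexCategory.σ 0 ≫ θ := hom_ext_cases h.symm fun _ => rfl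

/-- The value of `η` on a simplex of `X`. -/
def val (a : SimplexCategory) (x : X.obj (op ⦋a.len + 1⦌)) : K.obj (op a) := η.toFun a.len x

theorem val_extHom_of_zero {a b : SimplexCategory} (θ : a ⟶ b) (h : θ.toOrderHom 0 = 0)
    (x : X.obj (op b)) : η.val a (X.map (extHom θ).op x) = 0 := by
  rw [extHom_of_zero θ h, op_comp, Functor.map_comp]
  exact η.σ_zero _ _

/-- The compatibility of a twisting function with an arbitrary simplicial operator. -/
def Compat : MorphismProperty SimplexCategory := fun a b θ =>
  ∀ x : X.obj (op ⦋b.len + 1⦌),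
    K.map θ.op (η.val b x) + η.val a (X.map (extHom θ).op (X.δ 0 x)) =
      η.val a (X.map (joinHom θ).op x)

instance : η.Compat.IsMultiplicative where
  id_mem a x := by
    rw [joinHom_id, val_extHom_of_zero η _ rfl]
    simp
  comp_mem {a b c} φ ψ hφ hψ x := by
    have h₁ := hφ (X.map (joinHom ψ).op x)
    have h₂ := hφ (X.map (extHom ψ).op (X.δ 0 x))
    have h₃ := congrArg (K.map φ.op) (hψ x)
    have e₁ : X.δ 0 (X.map (joinHom ψ).op x) = X.map ψ.op (X.δ 0 x) := by
      change (X.map (joinHom ψ).op ≫ X.map (SimplexCategory.δ 0).op) x =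
        (X.map (SimplexCategory.δ 0).op ≫ X.map ψ.op) x
      rw [← X.map_comp, ← X.map_comp, ← op_comp, ← op_comp, δ_zero_joinHom]
    have e₂ : X.δ 0 (X.map (extHom ψ).op (X.δ 0 x)) = X.map ψ.op (X.δ 0 x) := by
      change (X.map (extHom ψ).op ≫ X.map (SimplexCategory.δ 0).op) _ = _
      rw [← X.map_comp, ← op_comp, δ_zero_extHom]
    have e₃ : X.map (joinHom φ).op (X.map (joinHom ψ).op x) = X.map (joinHom (φ ≫ ψ)).op x := by
      rw [joinHom_comp, op_comp, X.map_comp]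
      rfl
    have e₄ : X.map (joinHom φ).op (X.map (extHom ψ).op (X.δ 0 x)) =
        X.map (extHom (φ ≫ ψ)).op (X.δ 0 x) := by
      rw [← joinHom_extHom, op_comp, X.map_comp]
      rfl
    have e₅ : K.map (φ ≫ ψ).op (η.val c x) = K.map φ.op (K.map ψ.op (η.val c x)) := by
      rw [op_comp, K.map_comp]
      rfl
    rw [e₁, e₃] at h₁
    rw [e₂, e₄] at h₂
    rw [map_add] at h₃
    rw [e₅, ← h₂, ← h₁, ← h₃]
    abel

theorem compat {a b : SimplexCategory} (θ : a ⟶ b) : η.Compat θ := by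
  have h : η.Compat = ⊤ := by
    refine SimplexCategory.morphismProperty_eq_top _ (fun {n} i => ?_) (fun {n} i => ?_)
    · intro x
      induction i using Fin.cases with
      | zero =>
        have e₁ : extHom (SimplexCategory.δ (0 : Fin (n + 2))) = 𝟙 _ :=
          hom_ext_cases rfl fun _ => rfl
        have e₂ : joinHom (SimplexCategory.δ (0 : Fin (n + 2))) = SimplexCategory.δ 1 :=
          hom_ext_cases rfl fun _ => rfl
        rw [e₁, e₂]
        have h := η.δ_zero n x
        rw [eq_sub_iff_add_eq] at h
        have e₃ : X.map (𝟙 ⦋n + 1⦌).op (X.δ 0 x) = X.δ 0 x := by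
          rw [op_id, X.map_id]
          rfl
        exact (congrArg (fun z => K.δ 0 (η.toFun (n + 1) x) + η.toFun n z) e₃).trans h
      | succ j =>
        have e₂ : joinHom (SimplexCategory.δ j.succ) = SimplexCategory.δ j.succ.succ :=
          hom_ext_cases rfl fun i => (Fin.succ_succAbove_succ _ _).symm
        rw [e₂, val_extHom_of_zero η _ rfl, add_zero]
        exact η.δ_succ n j x
    · intro x
      have e₂ : joinHom (SimplexCategory.σ i) = SimplexCategory.σ i.succ :=
        hom_ext_cases rfl fun k => (Fin.succ_predAbove_succ _ _).symm
      rw [e₂, val_extHom_of_zero η _ rfl, add_zero]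
      exact η.σ n i x
  rw [h]
  trivial

/-- The operator `θ*` on `K ×_η X`. -/
def twMap {m n : SimplexCategoryᵒᵖ} (θ : m ⟶ n) (z : K.obj m × X.obj m) : K.obj n × X.obj n :=
  (K.map θ z.1 + η.val n.unop (X.map (extHom θ.unop).op z.2), X.map θ z.2)

/-- The simplicial set `K ×_η X`: its simplices are pairs `(k, x)`, and
`θ* (k, x) = (θ* k + η (θ⁺* x), θ* x)`; explicitly, `d₀ (k, x) = (d₀ k + η x, d₀ x)`, and the other
faces and all degeneracies are computed componentwise. -/
def twistedTotal : SSet.{u} where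
  obj n := Bun.ProdPt K X n
  map {m n} θ := ↾(fun z : Bun.ProdPt K X m => (η.twMap θ z : Bun.ProdPt K X n))
  map_id n := by
    refine ConcreteCategory.hom_ext _ _ fun z => ?_
    refine Prod.ext ?_ ?_
    · change K.map (𝟙 n) z.1 + η.val n.unop (X.map (extHom (𝟙 n.unop)).op z.2) = z.1
      rw [val_extHom_of_zero η _ rfl]
      simp
    · change X.map (𝟙 n) z.2 = z.2
      simp
  map_comp {l m n} θ ψ := by
    refine ConcreteCategory.hom_ext _ _ fun z => ?_
    refine Prod.ext ?_ ?_
    · change K.map (θ ≫ ψ) z.1 + η.val n.unop (X.map (extHom (ψ.unop ≫ θ.unop)).op z.2) =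
        K.map ψ (K.map θ z.1 + η.val m.unop (X.map (extHom θ.unop).op z.2)) +
          η.val n.unop (X.map (extHom ψ.unop).op (X.map θ z.2))
      have h := η.compat ψ.unop (X.map (extHom θ.unop).op z.2)
      have e₁ : X.δ 0 (X.map (extHom θ.unop).op z.2) = X.map θ z.2 := by
        change (X.map (extHom θ.unop).op ≫ X.map (SimplexCategory.δ 0).op) z.2 = _
        rw [← X.map_comp, ← op_comp, δ_zero_extHom]
        rfl
      have e₂ : X.map (joinHom ψ.unop).op (X.map (extHom θ.unop).op z.2) =
          X.map (extHom (ψ.unop ≫ θ.unop)).op z.2 := by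
        rw [← joinHom_extHom, op_comp, X.map_comp]
        rfl
      rw [e₁, e₂] at h
      rw [← h, map_add, K.map_comp, add_assoc]
      rfl
    · change X.map (θ ≫ ψ) z.2 = X.map ψ (X.map θ z.2)
      simp

theorem twistedTotal_δ_zero (n : ℕ) (k : K.obj (op ⦋n + 1⦌)) (x : X.obj (op ⦋n + 1⦌)) :
    η.twistedTotal.δ 0 ((k, x) : Bun.ProdPt K X _) =
      ((K.δ 0 k + η.toFun n x, X.δ 0 x) : Bun.ProdPt K X _) := by
  have e : extHom (SimplexCategory.δ (0 : Fin (n + 2))) = 𝟙 _ := hom_ext_cases rfl fun _ => rfl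
  change ((K.δ 0 k + η.val ⦋n⦌ (X.map (extHom (SimplexCategory.δ 0)).op x), X.δ 0 x) :
    Bun.ProdPt K X _) = _
  rw [e, op_id, X.map_id]
  rfl

theorem twistedTotal_δ_succ (n : ℕ) (i : Fin (n + 1)) (k : K.obj (op ⦋n + 1⦌))
    (x : X.obj (op ⦋n + 1⦌)) : η.twistedTotal.δ i.succ ((k, x) : Bun.ProdPt K X _) =
      ((K.δ i.succ k, X.δ i.succ x) : Bun.ProdPt K X _) :=
  Prod.ext ((congrArg (K.δ i.succ k + ·) (val_extHom_of_zero η _ rfl x)).trans (add_zero _)) rfl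

theorem twistedTotal_σ (n : ℕ) (i : Fin (n + 1)) (k : K.obj (op ⦋n⦌)) (x : X.obj (op ⦋n⦌)) :
    η.twistedTotal.σ i ((k, x) : Bun.ProdPt K X _) = ((K.σ i k, X.σ i x) : Bun.ProdPt K X _) :=
  Prod.ext ((congrArg (K.σ i k + ·) (val_extHom_of_zero η _ rfl x)).trans (add_zero _)) rfl

/-- The twisted product `K ×_η X` as a principal bundle over `X`. -/
def twistedProduct : Bun K X where
  total := η.twistedTotal
  action n := (inferInstance : AddAction (K.obj n) (Bun.ProdPt K X n))
  map_vadd {m n} θ k z := Prod.ext (by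
    change K.map θ (k + z.1) + _ = K.map θ k + (K.map θ z.1 + _)
    rw [map_add, add_assoc]
    rfl) rfl
  proj :=
    { app := fun n => ↾(fun z : Bun.ProdPt K X n => z.2)
      naturality := fun _ _ _ => rfl }
  free k z h := by
    have := congrArg Prod.fst h
    exact add_eq_right.mp this
  proj_surjective _ x := ⟨(0, x), rfl⟩
  proj_eq_iff := by
    rintro n ⟨k, x⟩ ⟨l, y⟩
    constructor
    · intro h
      change x = y at h
      subst h
      exact ⟨l - k, Prod.ext (sub_add_cancel l k) rfl⟩
    · rintro ⟨k, hk⟩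
      exact congrArg Prod.snd hk

/-- The comparison `(K ×_η X) ⊗_K (K ×_ζ X) ⟶ K ×_{η + ζ} X`, `[(k, x), (l, x)] ↦ (k + l, x)`. -/
def mulHom : η.twistedProduct ⊗ ζ.twistedProduct ⟶ (η + ζ).twistedProduct :=
  Bun.tensorDesc (fun n (z w : Bun.ProdPt K X n) _ => ((z.1 + w.1, z.2) : Bun.ProdPt K X n))
    (fun {n} k (z w : Bun.ProdPt K X n) h h' => Prod.ext (by
      change (k + z.1) + (-k + w.1) = z.1 + w.1
      abel) rfl)
    (fun {m n} θ (z w : Bun.ProdPt K X m) h h' => Prod.ext (by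
      have hzw : z.2 = w.2 := h
      change (K.map θ z.1 + η.val n.unop (X.map (extHom θ.unop).op z.2)) +
          (K.map θ w.1 + ζ.val n.unop (X.map (extHom θ.unop).op w.2)) =
        K.map θ (z.1 + w.1) + (η.val n.unop (X.map (extHom θ.unop).op z.2) +
          ζ.val n.unop (X.map (extHom θ.unop).op z.2))
      rw [map_add, hzw]
      abel) rfl)
    (fun {n} k (z w : Bun.ProdPt K X n) h h' => Prod.ext (add_assoc _ _ _) rfl)
    (fun _ _ _ => rfl)

variable (K X) in
/-- The comparison `K × X ⟶ K ×_0 X`, `(k, x) ↦ (k, x)`. -/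
def oneHom : 𝟙_ (Bun K X) ⟶ (0 : TwistingFunction K X).twistedProduct :=
  Bun.homMk (fun n (z : Bun.ProdPt K X n) => z)
    (fun {m n} θ (z : Bun.ProdPt K X m) => Prod.ext (add_zero (K.map θ z.1)).symm rfl)
    (fun _ _ => rfl) (fun _ => rfl)

end TwistingFunction

/-- A commutative monoid over the commutative monoid `B` with fibres `P b`, whose multiplication is
fibrewise biconvex. -/
structure FibrewiseBiconvexMonoid {B : Type u₁} [AddCommMonoid B] (P : B → Type u₂)
    [∀ b, ConvexSpace ℝ≥0 (P b)] where
  monoid : CommMonoid (Σ b, P b)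
  fst_one : (1 : Σ b, P b).1 = 0
  fst_mul : ∀ z w : Σ b, P b, (z * w).1 = z.1 + w.1
  biconvex : ∀ b c : B, IsBiconvex fun (p : P b) (q : P c) =>
    (cast (congrArg P (fst_mul ⟨b, p⟩ ⟨c, q⟩)) (⟨b, p⟩ * ⟨c, q⟩ : Σ b, P b).2 : P (b + c))

/-- The set of simplicial distributions on `K ×_η X`. -/
abbrev TwistedDist (η : TwistingFunction K X) : Type u := SDist η.twistedProduct.proj

/-- The product `sDist(π_η) × sDist(π_ζ) → sDist(π_{η + ζ})`. -/
def twistedMul {η ζ : TwistingFunction K X} (p : TwistedDist η) (q : TwistedDist ζ) :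
    TwistedDist (η + ζ) :=
  ((sDist K X).map (η.mulHom ζ)).toFun (Bun.sDistMul p q)

variable (K X) in
/-- The unit in `sDist(π_0)`. -/
def twistedOne : TwistedDist (0 : TwistingFunction K X) :=
  ((sDist K X).map (TwistingFunction.oneHom K X)).toFun (Bun.sDistUnit K X)

end ConvexGC

end

open CategoryTheory MonoidalCategory ConvexGC

noncomputable section

namespace ConvexGC

open Convexity Opposite Simplicial
open scoped NNReal

/-! ### Convex combinations and product distributions -/

/-! Everything rests on a Fubini formula. Over a simplex `x` the distribution `μ(p, q)` is the image
of the product of `p_x` and `q_x`, so a convex combination along it is an iterated one: first along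
`p_x`, then along `q_x` (`sDistMul_iConvexComb`). The class `[a, c]` exists only when `a` and `c`
lie over the same simplex. This costs nothing: `p_x` and `q_x` are concentrated on the fibres over
`x`, so a function on `E ⊗_K F` may be replaced by any function on all pairs that extends it
(`exists_pair_extension`).

Through this formula each property of `μ` becomes a property of iterated finite sums. Biconvexity is
associativity and interchange of sums; naturality, associativity and unitality are evaluations on
classes of points; symmetry is interchange of sums. A biconvex map is the same as a convex map out
of the tensor product, and two convex maps out of a tensor product agree once they agree on pure
tensors, so these facts about elements give a lax symmetric monoidal functor (`sDistLaxBraided`).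

The second part holds for every lax symmetric monoidal functor `F` to convex sets
(`grothFibration`). A morphism of `∫ F` is a morphism of the base subject to a condition on
elements, and the projection is faithful. Evaluated on pure tensors, the axioms of `F` say that the
tensor products of morphisms and the coherence isomorphisms of the base satisfy the condition, so
they lift; their equations hold because they hold below. The fibre over `c`, and the fibre over any
morphism with source `c`, is a copy of `F c`. In these coordinates source and identity are identity
maps, target over `f` is `F f`, and the tensor product is `μ`, so all convexity requirements are
inherited from `F`.

For the third part, all twisted products have the same sets of simplices, and the product of `p` and
`q` is fibrewise convolution over `K`. The monoid laws therefore reduce to those of addition in `K`,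
and biconvexity is that of `μ` followed by a convex push-forward. -/

theorem restrictTo_iConvexComb {M Z : Type*} [ConvexSpace ℝ≥0 Z] (s : M → Prop) (d : Dist M)
    (h : ∀ m, d.weights m ≠ 0 → s m) {g : {m // s m} → Z} {G : M → Z}
    (hG : ∀ m, d.weights m.1 ≠ 0 → g m = G m.1) :
    (restrictTo s d h).iConvexComb g = d.iConvexComb G := by
  -- The distribution `d` is the push-forward of its restriction along the inclusion, so both sides
  -- become combinations along the same distribution on the subtype.
  conv_rhs => rw [← restrictTo_map_val s d h, iConvexComb_map]
  exact Convexity.iConvexComb_congr hG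

variable {K : SimplicialObject AddCommGrpCat.{u}} {X : SSet.{u}}

/-- Only points over `x` carry weight in `p_x`, so functions need to be compared on that fibre
alone. -/
theorem SDist.iConvexComb_congr {E : SSet.{u}} {π : E ⟶ X} {Z : Type*} [ConvexSpace ℝ≥0 Z]
    (p : SDist π) {n : SimplexCategoryᵒᵖ} (x : X.obj n) {f g : E.obj n → Z}
    (h : ∀ e, π.app n e = x → f e = g e) :
    (p.eval x).iConvexComb f = (p.eval x).iConvexComb g :=
  Convexity.iConvexComb_congr fun e he => h e (p.proj_eq_of_weights_ne_zero x e he)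

theorem iConvexComb_single_self {A : Type*} (p : Dist A) :
    p.iConvexComb (fun a => (StdSimplex.single a : Dist A)) = p :=
  (iConvexComb_single_eq_map p id).trans (StdSimplex.map_id p)

/-! ### The Fubini formula for `μ` and the laws it yields -/

namespace Bun

variable {E F G : Bun K X}

theorem eval_sDist_map (f : E ⟶ F) (p : SDist E.proj) {n : SimplexCategoryᵒᵖ} (x : X.obj n) :
    SDist.eval (π := F.proj) (((sDist K X).map f).toFun p) x =
      (p.eval x).iConvexComb fun e => StdSimplex.single (ap f e) :=
  (iConvexComb_single_eq_map _ _).symm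

/-- Convex combinations along `μ_{E,F}(p, q)` are iterated convex combinations. -/
theorem sDistMul_iConvexComb {Z : Type*} [ConvexSpace ℝ≥0 Z] (p : SDist E.proj) (q : SDist F.proj)
    {n : SimplexCategoryᵒᵖ} (x : X.obj n) {g : (E ⊗ F).pt n → Z} {b : E.pt n → F.pt n → Z}
    (hb : ∀ a c h, E.proj.app n a = x → F.proj.app n c = x → g (pair a c h) = b a c) :
    ((sDistMul p q).eval x).iConvexComb g =
      (p.eval x).iConvexComb fun a => (q.eval x).iConvexComb fun c => b a c := by
  have h : ((sDistMul p q).eval x).iConvexComb g =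
      (fibProd p q x).iConvexComb fun z => g (pair z.1.1 z.1.2 z.2) := iConvexComb_map _ _ _
  -- The iterated sum is a combination along the product distribution on all pairs, of which
  -- `fibProd` is the restriction to the fibre product. Pairs of nonzero weight have both entries
  -- over `x`, which is exactly where `hb` applies.
  rw [h, ← prodDist_iConvexComb (p.eval x) (q.eval x) fun z => b z.1 z.2]
  refine restrictTo_iConvexComb _ _ _ fun m hm => ?_
  rw [prodDist_weights] at hm
  exact hb _ _ _ (p.proj_eq_of_weights_ne_zero x _ (left_ne_zero_of_mul hm))
    (q.proj_eq_of_weights_ne_zero x _ (right_ne_zero_of_mul hm))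

/-- A distribution is the combination of its own delta distributions, so this is the Fubini formula
for the function `w ↦ δ_w`. -/
theorem sDistMul_eval (p : SDist E.proj) (q : SDist F.proj) {n : SimplexCategoryᵒᵖ} (x : X.obj n)
    {b : E.pt n → F.pt n → Dist ((E ⊗ F).pt n)}
    (hb : ∀ a c h, StdSimplex.single (pair a c h) = b a c) :
    (sDistMul p q).eval x =
      (p.eval x).iConvexComb fun a => (q.eval x).iConvexComb fun c => b a c :=
  (iConvexComb_single_self _).symm.trans (sDistMul_iConvexComb p q x fun a c h _ _ => hb a c h)

/-- A function on `E ⊗_K F` comes from a function on all pairs. -/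
theorem exists_pair_extension {Z : Type*} [Nonempty Z] {n : SimplexCategoryᵒᵖ}
    (g : (E ⊗ F).pt n → Z) :
    ∃ b : E.pt n → F.pt n → Z, ∀ a c h, g (pair a c h) = b a c := by
  classical
  -- The value at pairs lying over different simplices is irrelevant: such pairs have weight zero in
  -- every product `p_x q_x`.
  exact ⟨fun a c => if h : E.proj.app n a = F.proj.app n c then g (pair a c h) else
    Classical.arbitrary Z, fun a c h => by simp only [dif_pos h]⟩

/-- Supplies the default value for `exists_pair_extension`. A simplex `x` of the base is needed,
since `X` may have no simplices in a given dimension. -/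
theorem nonempty_dist (E : Bun K X) {n : SimplexCategoryᵒᵖ} (x : X.obj n) :
    Nonempty (Dist (E.pt n)) :=
  ⟨StdSimplex.single (E.proj_surjective n x).choose⟩

theorem isBiconvex_sDistMul :
    IsBiconvex (sDistMul : SDist E.proj → SDist F.proj → SDist (E ⊗ F).proj) := by
  -- The extension `b` is chosen before `p` and `q`, so that one formula serves a convex combination
  -- and all of its terms.
  have key : ∀ (n : SimplexCategoryᵒᵖ) (x : X.obj n), ∃ b : E.pt n → F.pt n → Dist ((E ⊗ F).pt n),
      ∀ (p : SDist E.proj) (q : SDist F.proj), (sDistMul p q).eval x =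
        (p.eval x).iConvexComb fun a => (q.eval x).iConvexComb fun c => b a c := by
    intro n x
    have := nonempty_dist (E ⊗ F) x
    obtain ⟨b, hb⟩ := exists_pair_extension
      (fun w : (E ⊗ F).pt n => (StdSimplex.single w : Dist _))
    exact ⟨b, fun p q => sDistMul_eval p q x hb⟩
  refine .of_left_right (fun q => ⟨fun w => ?_⟩) fun p => ⟨fun w => ?_⟩
  · ext n x : 2
    obtain ⟨b, hb⟩ := key n x
    rw [SDist.sConvexComb_eval, iConvexComb_map, hb, SDist.sConvexComb_eval, ← iConvexComb_assoc]
    simp only [hb]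
  · ext n x : 2
    obtain ⟨b, hb⟩ := key n x
    rw [SDist.sConvexComb_eval, iConvexComb_map, hb, SDist.sConvexComb_eval]
    simp only [hb, ← iConvexComb_assoc]
    -- In the second variable the combination along `w` sits inside the one along `p_x`;
    -- interchanging the two finite sums brings it outside.
    rw [iConvexComb_comm]

theorem map_sDistMul {E' F' : Bun K X} (f : E ⟶ E') (g : F ⟶ F') (p : SDist E.proj)
    (q : SDist F.proj) :
    ((sDist K X).map (tensorMap f g)).toFun (sDistMul p q) =
      sDistMul (((sDist K X).map f).toFun p) (((sDist K X).map g).toFun q) := by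
  refine SDist.ext fun n x => ?_
  have := nonempty_dist (E' ⊗ F') x
  -- The extension is chosen on the target and pulled back along `f` and `g`, so both sides are
  -- double combinations of the same function.
  obtain ⟨b, hb⟩ := exists_pair_extension
    (fun w : (E' ⊗ F').pt n => (StdSimplex.single w : Dist _))
  refine (eval_sDist_map _ _ x).trans ?_
  refine Eq.trans ?_ (sDistMul_eval (SDist.map f.toMap f.over_base p)
    (SDist.map g.toMap g.over_base q) x hb).symm
  refine (sDistMul_iConvexComb p q x (b := fun a c => b (ap f a) (ap g c))
    fun a c h _ _ => hb (ap f a) (ap g c) (by simpa using h)).trans ?_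
  rw [SDist.map_eval', SDist.map_eval', iConvexComb_map]
  simp only [iConvexComb_map]
  rfl

/-- Both bracketings are triple combinations of `δ_[e, [f, g]]`. Three extensions are involved: `l`
and `m` come from the two outer pairings, and `b`, a function of triples, is the common form to
which both are reduced. -/
theorem map_assocHom_sDistMul (p : SDist E.proj) (q : SDist F.proj) (r : SDist G.proj) :
    ((sDist K X).map (assocHom E F G)).toFun (sDistMul (sDistMul p q) r) =
      sDistMul p (sDistMul q r) := by
  classical
  refine SDist.ext fun n x => ?_
  have hne := nonempty_dist (E ⊗ F ⊗ G) x
  obtain ⟨b, hb⟩ : ∃ b : E.pt n → F.pt n → G.pt n → Dist ((E ⊗ F ⊗ G).pt n),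
      ∀ e f g h h', b e f g = StdSimplex.single (pair e (pair f g h) h') :=
    ⟨fun e f g => if h : E.proj.app n e = F.proj.app n f ∧ F.proj.app n f = G.proj.app n g then
      StdSimplex.single (pair e (pair f g h.2) h.1) else Classical.arbitrary _,
      fun e f g h h' => dif_pos ⟨h', h⟩⟩
  obtain ⟨l, hl⟩ := exists_pair_extension (E := E ⊗ F) (F := G) fun w =>
    (StdSimplex.single (ap (assocHom E F G) w) : Dist ((E ⊗ F ⊗ G).pt n))
  obtain ⟨m, hm⟩ := exists_pair_extension (E := E) (F := F ⊗ G) fun w =>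
    (StdSimplex.single w : Dist ((E ⊗ F ⊗ G).pt n))
  refine (eval_sDist_map _ _ x).trans ?_
  refine (sDistMul_iConvexComb _ r x fun a c h _ _ => hl a c h).trans ?_
  -- The functions `l` and `b` agree only on triples over a single simplex, so the innermost
  -- combinations are compared on the fibre of `G` over `x`.
  refine (sDistMul_iConvexComb p q x (b := fun e f => (r.eval x).iConvexComb (b e f))
    fun e f h he hf => r.iConvexComb_congr x fun g hg => ?_).trans ?_
  · rw [← hl _ _ (he.trans hg.symm), hb e f g (hf.trans hg.symm) h]
    exact congrArg _ (assocHom_pair _ _ _ _ _)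
  refine Eq.trans ?_ (sDistMul_eval p (sDistMul q r) x hm).symm
  refine p.iConvexComb_congr x fun e he => ?_
  refine (sDistMul_iConvexComb q r x fun f g h hf hg => ?_).symm
  exact (hm e (pair f g h) (he.trans hf.symm)).symm.trans (hb e f g h (he.trans hf.symm)).symm

theorem map_leftUnitorHom_sDistMul (p : SDist E.proj) :
    ((sDist K X).map (leftUnitorHom E)).toFun (sDistMul (sDistUnit K X) p) = p := by
  refine SDist.ext fun n x => ?_
  refine (eval_sDist_map _ _ x).trans ?_
  refine (sDistMul_iConvexComb (sDistUnit K X) p x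
    -- Here no default value is needed: `k +ᵥ e` makes sense for every pair of `(k, y)` and `e`.
    (b := fun (z : ProdPt K X n) e => (StdSimplex.single (z.1 +ᵥ e) : Dist (E.pt n)))
    fun _ _ _ _ _ => rfl).trans ?_
  -- The unit is a delta distribution, so the outer combination collapses to its value at `(0, x)`,
  -- and `0` acts trivially.
  refine (iConvexComb_single _ _).trans ?_
  refine Eq.trans ?_ (iConvexComb_single_self _)
  exact congrArg _ (funext fun e => congrArg _ (zero_vadd _ e))

theorem map_rightUnitorHom_sDistMul (p : SDist E.proj) :
    ((sDist K X).map (rightUnitorHom E)).toFun (sDistMul p (sDistUnit K X)) = p := by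
  refine SDist.ext fun n x => ?_
  refine (eval_sDist_map _ _ x).trans ?_
  refine (sDistMul_iConvexComb p (sDistUnit K X) x
    (b := fun e (z : ProdPt K X n) => (StdSimplex.single (z.1 +ᵥ e) : Dist (E.pt n)))
    fun _ _ _ _ _ => rfl).trans ?_
  refine Eq.trans ?_ (iConvexComb_single_self _)
  refine congrArg _ (funext fun e => ?_)
  exact (iConvexComb_single _ _).trans (congrArg _ (zero_vadd _ e))

/-- The product distribution is symmetric up to swapping the factors, which here is the interchange
of two finite sums. -/
theorem map_braidHom_sDistMul (p : SDist E.proj) (q : SDist F.proj) :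
    ((sDist K X).map (braidHom E F)).toFun (sDistMul p q) = sDistMul q p := by
  refine SDist.ext fun n x => ?_
  have := nonempty_dist (F ⊗ E) x
  obtain ⟨b, hb⟩ := exists_pair_extension
    (fun w : (F ⊗ E).pt n => (StdSimplex.single w : Dist _))
  refine (eval_sDist_map _ _ x).trans ?_
  refine Eq.trans ?_ (sDistMul_eval q p x hb).symm
  rw [iConvexComb_comm]
  exact sDistMul_iConvexComb p q x fun a c h _ _ => hb c a h.symm

end Bun

/-! ### The lax symmetric monoidal functor of simplicial distributions -/

/-- The map `μ_{E,F}` as a convex map out of the tensor product. -/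
def sDistμ (E F : Bun K X) :
    CSet.tensor ((sDist K X).obj E) ((sDist K X).obj F) ⟶ (sDist K X).obj (Bun.tensor E F) :=
  CSet.lift (A := (sDist K X).obj E) (B := (sDist K X).obj F)
    (C := (sDist K X).obj (Bun.tensor E F)) Bun.sDistMul Bun.isBiconvex_sDistMul

theorem sDistμ_tmul {E F : Bun K X} (p : ((sDist K X).obj E).carrier)
    (q : ((sDist K X).obj F).carrier) :
    (sDistμ E F).toFun (CSet.tmul p q) = Bun.sDistMul p q := CSet.lift_tmul ..

variable (K X) in
/-- The map `* ⟶ sDist (K × X)` picking out the unit. -/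
def sDistε : CSet.one ⟶ (sDist K X).obj (Bun.trivial K X) :=
  ⟨fun _ => Bun.sDistUnit K X, IsAffineMap.const _⟩

/-- Convex maps out of a tensor product are determined by pure tensors, so this and the coherence
laws below are the identities for `sDistMul` already proved. -/
theorem sDistμ_natural {E F E' F' : Bun K X} (f : E ⟶ E') (g : F ⟶ F') :
    CSet.tensorMap ((sDist K X).map f) ((sDist K X).map g) ≫ sDistμ E' F' =
      sDistμ E F ≫ (sDist K X).map (Bun.tensorMap f g) :=
  CSet.tensor_hom_ext fun p q => by
    rw [CSet.comp_toFun, CSet.comp_toFun, CSet.tensorMap_tmul, sDistμ_tmul, sDistμ_tmul]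
    exact (Bun.map_sDistMul f g p q).symm

theorem sDistμ_assoc (E F G : Bun K X) :
    CSet.tensorMap (sDistμ E F) (𝟙 ((sDist K X).obj G)) ≫ sDistμ (Bun.tensor E F) G ≫
        (sDist K X).map (Bun.assocHom E F G) =
      CSet.assocHom _ _ _ ≫ CSet.tensorMap (𝟙 ((sDist K X).obj E)) (sDistμ F G) ≫
        sDistμ E (Bun.tensor F G) :=
  CSet.tensor_hom_ext₃ fun p q r => by
    simp only [CSet.comp_toFun, CSet.tensorMap_tmul, CSet.assocHom_tmul, CSet.id_toFun,
      sDistμ_tmul]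
    exact (congrArg ((sDist K X).map (Bun.assocHom E F G)).toFun
      (sDistμ_tmul (E := Bun.tensor E F) (Bun.sDistMul p q) r)).trans
        ((Bun.map_assocHom_sDistMul p q r).trans
          (sDistμ_tmul (F := Bun.tensor F G) p (Bun.sDistMul q r)).symm)

theorem sDistμ_leftUnitor (E : Bun K X) :
    (CSet.leftUnitor ((sDist K X).obj E)).hom =
      CSet.tensorMap (sDistε K X) (𝟙 ((sDist K X).obj E)) ≫ sDistμ (Bun.trivial K X) E ≫
        (sDist K X).map (Bun.leftUnitorHom E) :=
  CSet.tensor_hom_ext fun a p => by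
    simp only [CSet.comp_toFun, CSet.tensorMap_tmul, CSet.leftUnitor_tmul, CSet.id_toFun,
      sDistμ_tmul]
    exact (Bun.map_leftUnitorHom_sDistMul p).symm

theorem sDistμ_rightUnitor (E : Bun K X) :
    (CSet.rightUnitor ((sDist K X).obj E)).hom =
      CSet.tensorMap (𝟙 ((sDist K X).obj E)) (sDistε K X) ≫ sDistμ E (Bun.trivial K X) ≫
        (sDist K X).map (Bun.rightUnitorHom E) :=
  CSet.tensor_hom_ext fun p a => by
    simp only [CSet.comp_toFun, CSet.tensorMap_tmul, CSet.rightUnitor_tmul, CSet.id_toFun,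
      sDistμ_tmul]
    exact (Bun.map_rightUnitorHom_sDistMul p).symm

theorem sDistμ_braid (E F : Bun K X) :
    sDistμ E F ≫ (sDist K X).map (Bun.braidHom E F) =
      (CSet.braid ((sDist K X).obj E) ((sDist K X).obj F)).hom ≫ sDistμ F E :=
  CSet.tensor_hom_ext fun p q => by
    simp only [CSet.comp_toFun, CSet.braid_tmul, sDistμ_tmul]
    exact Bun.map_braidHom_sDistMul p q

variable (K X) in
/-- The lax symmetric monoidal structure on `sDist` with structure maps `μ_{E,F}`. -/
@[reducible]
def sDistLaxBraided : (sDist K X).LaxBraided where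
  ε := sDistε K X
  μ := sDistμ
  -- Whiskering in both categories is by definition a tensor product with an identity, so one-sided
  -- naturality is `sDistμ_natural` with one map an identity.
  μ_natural_left f F := by
    have h := sDistμ_natural f (𝟙 F)
    rwa [CategoryTheory.Functor.map_id] at h
  μ_natural_right E f := by
    have h := sDistμ_natural (𝟙 E) f
    rwa [CategoryTheory.Functor.map_id] at h
  associativity := sDistμ_assoc
  left_unitality := sDistμ_leftUnitor
  right_unitality := sDistμ_rightUnitor
  braided := sDistμ_braid

/-! ### Convex structures transported along bijections -/

/-- The convex structure on `A` for which the bijection `e : A ≃ B` is convex. -/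
@[reducible]
def convexSpaceOfEquiv {A B : Type*} [ConvexSpace ℝ≥0 B] (e : A ≃ B) : ConvexSpace ℝ≥0 A :=
  ConvexSpace.mk (fun w => e.symm (w.iConvexComb e)) (fun x => by simp)
    (fun f => by
      congr 1
      -- Once `e` cancels against its inverse, the associativity law is the one of `B`.
      rw [iConvexComb_map, ← iConvexComb_id' f, ← iConvexComb_assoc]
      simp only [Equiv.apply_symm_apply])

/-- Convexity can be tested in coordinates: `f` is convex if the map `g` that it becomes under the
two bijections is. -/
theorem isAffineMap_of_equiv {A B A' B' : Type*} [ConvexSpace ℝ≥0 A'] [ConvexSpace ℝ≥0 B']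
    (e : A ≃ A') (e' : B ≃ B') {f : A → B} {g : A' → B'} (hg : IsAffineMap ℝ≥0 g)
    (h : ∀ a, e' (f a) = g (e a)) :
    letI := convexSpaceOfEquiv e
    letI := convexSpaceOfEquiv e'
    IsAffineMap ℝ≥0 f := by
  let := convexSpaceOfEquiv e
  let := convexSpaceOfEquiv e'
  refine ⟨fun w => e'.injective ?_⟩
  change e' (f (e.symm (w.iConvexComb e))) = e' (e'.symm ((w.map f).iConvexComb e'))
  rw [h, e.apply_symm_apply, e'.apply_symm_apply, hg.map_iConvexComb, iConvexComb_map]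
  congr 1
  funext a
  exact (h a).symm

theorem isAffineMap_equiv_symm {A B : Type*} [ConvexSpace ℝ≥0 B] (e : A ≃ B) :
    letI := convexSpaceOfEquiv e
    IsAffineMap ℝ≥0 e.symm := by
  let := convexSpaceOfEquiv e
  refine ⟨fun w => ?_⟩
  change _ = e.symm ((w.map e.symm).iConvexComb e)
  rw [iConvexComb_map]
  simp only [Equiv.apply_symm_apply, iConvexComb_id']

/-- Biconvexity amounts to convexity in each variable separately, so the one-variable transport
applies to each slice. -/
theorem isBiconvex_of_equiv {A B : Type u₁} {A' B' : Type u₂} {Z Z' : Type*} [ConvexSpace ℝ≥0 A'] [ConvexSpace ℝ≥0 B']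
    [ConvexSpace ℝ≥0 Z'] (e₁ : A ≃ A') (e₂ : B ≃ B') (e₃ : Z ≃ Z') {f : A → B → Z}
    {g : A' → B' → Z'} (hg : IsBiconvex g) (h : ∀ a b, e₃ (f a b) = g (e₁ a) (e₂ b)) :
    letI := convexSpaceOfEquiv e₁
    letI := convexSpaceOfEquiv e₂
    letI := convexSpaceOfEquiv e₃
    IsBiconvex f := by
  let := convexSpaceOfEquiv e₁
  let := convexSpaceOfEquiv e₂
  let := convexSpaceOfEquiv e₃
  exact IsBiconvex.of_left_right (f := f)
    (fun b => isAffineMap_of_equiv e₁ e₃ (hg.left (e₂ b)) fun a => h a b)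
    (fun a => isAffineMap_of_equiv e₂ e₃ (hg.right (e₁ a)) fun b => h a b)

/-! ### The Grothendieck construction of a functor to convex sets -/

section Groth

open Functor.LaxMonoidal

variable {C : Type u₁} [Category.{v₁} C] (F : C ⥤ CSet.{u})

/-- The fibre of `∫ F` over `c` is `F c`. -/
def grothFibreEquiv (c : C) : (groth F).Fiber c ≃ (F.obj c).carrier where
  toFun x := cast (congrArg (fun d => (F.obj d).carrier) x.2) x.1.2
  invFun := grothFibreMk F c
  left_inv := by
    rintro ⟨⟨c, x⟩, rfl⟩
    rfl
  right_inv _ := rfl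

/-- The fibre of `∫ F` over a morphism `f : c ⟶ d` is `F c`. -/
def grothFibreHomEquiv {c d : C} (f : c ⟶ d) : FibreHom (groth F) f ≃ (F.obj c).carrier where
  -- A morphism over `f` is determined by its source `x`: its target can only be `F f x`.
  toFun φ := grothFibreEquiv F c φ.source
  invFun x := ⟨grothFibreMk F c x, grothFibreMk F d ((F.map f).toFun x), ⟨f, rfl⟩,
    IsHomLift.map (groth F) (⟨f, rfl⟩ : grothMk F c x ⟶ grothMk F d ((F.map f).toFun x))⟩
  left_inv := by
    rintro ⟨⟨⟨c, x⟩, rfl⟩, ⟨⟨d, y⟩, rfl⟩, φ, h⟩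
    have hf := IsHomLift.eq_of_isHomLift (groth F) f φ
    change c ⟶ d at f
    obtain ⟨g, hy⟩ := φ
    obtain rfl : f = g := hf
    change (F.map f).toFun x = y at hy
    subst hy
    rfl
  right_inv _ := rfl

/-- In the coordinates given by the source, the target map is `F f`. This reduces its convexity to
that of `F f`. -/
theorem grothFibreEquiv_target {c d : C} (f : c ⟶ d) (φ : FibreHom (groth F) f) :
    grothFibreEquiv F d φ.target = (F.map f).toFun (grothFibreHomEquiv F f φ) := by
  obtain ⟨x, rfl⟩ := (grothFibreHomEquiv F f).symm.surjective φ
  rfl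

/-- The fibrewise convex structure on `∫ F`. -/
def grothConvex : FibrewiseConvexStructure (groth F) where
  obj c := convexSpaceOfEquiv (grothFibreEquiv F c)
  hom f := convexSpaceOfEquiv (grothFibreHomEquiv F f)
  source f := isAffineMap_of_equiv (grothFibreHomEquiv F f) (grothFibreEquiv F _) IsAffineMap.id
    fun _ => rfl
  target f := isAffineMap_of_equiv (grothFibreHomEquiv F f) (grothFibreEquiv F _) (F.map f).affine
    (grothFibreEquiv_target F f)
  identity c := isAffineMap_of_equiv (grothFibreEquiv F c) (grothFibreHomEquiv F (𝟙 c))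
    IsAffineMap.id fun _ => rfl

/-- A morphism of `∫ F` is a morphism of the base that carries one element to the other. Hence it is
determined by its image, and its target by its image and source. -/
theorem isDiscreteFibration_groth : IsDiscreteFibration (groth F) where
  discrete c :=
    { subsingleton := fun x y => ⟨fun φ ψ => by
        obtain ⟨⟨c, x⟩, rfl⟩ := x
        obtain ⟨φ, hφ⟩ := φ
        obtain ⟨ψ, hψ⟩ := ψ
        refine Subtype.ext (CategoryOfElements.ext _ _ _ ?_)
        exact (@IsHomLift.fac' _ _ _ _ (groth F) _ _ _ _ _ φ hφ).trans
          (@IsHomLift.fac' _ _ _ _ (groth F) _ _ _ _ _ ψ hψ).symm⟩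
      eq_of_hom := by
        -- A morphism in a fibre lies over an identity, so its condition on elements reads `x = y`.
        rintro ⟨⟨c, x⟩, rfl⟩ ⟨⟨d, y⟩, h⟩ ⟨φ, hφ⟩
        change d = c at h
        subst h
        have hf := @IsHomLift.eq_of_isHomLift _ _ _ _ (groth F) (grothMk F d x) (grothMk F d y)
          (𝟙 d) φ hφ
        obtain ⟨f, hy⟩ := φ
        change 𝟙 d = f at hf
        subst hf
        rw [(F ⋙ CSet.forget).map_id] at hy
        change x = y at hy
        subst hy
        rfl }
  coCartesian {x y} φ :=
    { universal_property' := by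
        intro z g ψ hψ
        have hf := IsHomLift.eq_of_isHomLift (groth F) ((groth F).map φ ≫ g) ψ
        -- The factorization must lie over `g`, which gives uniqueness. It exists because `F g`
        -- applied to `F φ x` is `F (φ ≫ g) x`, the element of `z`.
        refine ⟨⟨g, ?_⟩, ⟨IsHomLift.map (groth F) (⟨g, _⟩ : y ⟶ z), CategoryOfElements.ext _ _ _ hf⟩,
          fun χ hχ => CategoryOfElements.ext _ _ _ ?_⟩
        · have h₁ := φ.2
          have h₂ := ψ.2
          have h₃ : φ.1 ≫ g = ψ.1 := hf
          rw [← h₃] at h₂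
          rw [← h₁]
          exact (congrArg (fun h => CSet.Hom.toFun h x.2) (F.map_comp φ.1 g)).symm.trans h₂
        · have := hχ.1
          exact (IsHomLift.eq_of_isHomLift (groth F) g χ).symm }
  exists_lift x c f :=
    ⟨grothMk F c ((F.map f).toFun x.2), ⟨f, rfl⟩, IsHomLift.map (groth F)
      (⟨f, rfl⟩ : x ⟶ grothMk F c ((F.map f).toFun x.2))⟩

/-! ### Monoidal structure on the Grothendieck construction -/

section Monoidal

variable [MonoidalCategory C] [F.LaxMonoidal]

/-- The map `F c × F d → F (c ⊗ d)`. -/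
def laxMul {c d : C} (x : (F.obj c).carrier) (y : (F.obj d).carrier) : (F.obj (c ⊗ d)).carrier :=
  (μ F c d).toFun (CSet.tmul x y)

theorem isBiconvex_laxMul (c d : C) :
    IsBiconvex (laxMul F : (F.obj c).carrier → (F.obj d).carrier → _) :=
  CSet.isBiconvex_tmul.comp_affine (μ F c d).affine

/-- The unit element of `F (𝟙_ C)`. -/
def laxUnit : (F.obj (𝟙_ C)).carrier := (ε F).toFun PUnit.unit

/-- Naturality of `μ` evaluated on a pure tensor. It is the condition for `f ⊗ g` to be a morphism
of `∫ F`. -/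
theorem map_laxMul {c d c' d' : C} (f : c ⟶ c') (g : d ⟶ d') (x : (F.obj c).carrier)
    (y : (F.obj d).carrier) : (F.map (f ⊗ₘ g)).toFun (laxMul F x y) =
      laxMul F ((F.map f).toFun x) ((F.map g).toFun y) := by
  have h := congrArg (fun φ => φ.toFun (CSet.tmul x y)) (μ_natural F f g)
  refine h.symm.trans (congrArg (μ F c' d').toFun ?_)
  exact CSet.tensorMap_tmul (F.map f) (F.map g) x y

/-- Evaluating the associativity axiom of `F` on a pure tensor shows that the associator of the base
lifts to `∫ F`; the unit axioms below do the same for the unitors. -/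
theorem map_associator_laxMul {c d e : C} (x : (F.obj c).carrier) (y : (F.obj d).carrier)
    (z : (F.obj e).carrier) : (F.map (α_ c d e).hom).toFun (laxMul F (laxMul F x y) z) =
      laxMul F x (laxMul F y z) := by
  have h := congrArg (fun φ => φ.toFun (CSet.tmul (CSet.tmul x y) z)) (associativity F c d e)
  have h₁ : (CSet.tensorMap (μ F c d) (𝟙 (F.obj e))).toFun (CSet.tmul (CSet.tmul x y) z) =
      CSet.tmul (laxMul F x y) z := CSet.tensorMap_tmul _ _ _ _
  have h₂ : (CSet.tensorMap (𝟙 (F.obj c)) (μ F d e)).toFun (CSet.tmul x (CSet.tmul y z)) =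
      CSet.tmul x (laxMul F y z) := CSet.tensorMap_tmul _ _ _ _
  refine (congrArg (fun t => (F.map (α_ c d e).hom).toFun ((μ F (c ⊗ d) e).toFun t)) h₁).symm.trans
    (h.trans ?_)
  exact congrArg (μ F c (d ⊗ e)).toFun ((congrArg (CSet.tensorMap (𝟙 (F.obj c)) (μ F d e)).toFun
    (CSet.assocHom_tmul x y z)).trans h₂)

theorem map_leftUnitor_laxMul {c : C} (x : (F.obj c).carrier) :
    (F.map (λ_ c).hom).toFun (laxMul F (laxUnit F) x) = x := by
  have h := congrArg (fun φ => φ.toFun (CSet.tmul (A := CSet.one) PUnit.unit x))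
    (left_unitality F c)
  have h₁ : (CSet.tensorMap (ε F) (𝟙 (F.obj c))).toFun (CSet.tmul (A := CSet.one) PUnit.unit x) =
      CSet.tmul (laxUnit F) x := CSet.tensorMap_tmul _ _ _ _
  refine (congrArg (fun t => (F.map (λ_ c).hom).toFun ((μ F (𝟙_ C) c).toFun t)) h₁).symm.trans
    (h.symm.trans ?_)
  exact CSet.leftUnitor_tmul _ _ _

theorem map_rightUnitor_laxMul {c : C} (x : (F.obj c).carrier) :
    (F.map (ρ_ c).hom).toFun (laxMul F x (laxUnit F)) = x := by
  have h := congrArg (fun φ => φ.toFun (CSet.tmul (B := CSet.one) x PUnit.unit))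
    (right_unitality F c)
  have h₁ : (CSet.tensorMap (𝟙 (F.obj c)) (ε F)).toFun (CSet.tmul (B := CSet.one) x PUnit.unit) =
      CSet.tmul x (laxUnit F) := CSet.tensorMap_tmul _ _ _ _
  refine (congrArg (fun t => (F.map (ρ_ c).hom).toFun ((μ F c (𝟙_ C)).toFun t)) h₁).symm.trans
    (h.symm.trans ?_)
  exact CSet.rightUnitor_tmul _ _ _

instance grothMonoidalStruct : MonoidalCategoryStruct (F ⋙ CSet.forget).Elements where
  tensorObj x y := grothMk F (x.1 ⊗ y.1) (laxMul F x.2 y.2)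
  tensorHom {x x' y y'} f g := ⟨f.1 ⊗ₘ g.1, (map_laxMul F f.1 g.1 x.2 y.2).trans
    (congrArg₂ (laxMul F) f.2 g.2)⟩
  -- Since `map_laxMul` speaks of tensor products of two morphisms, whiskering is rewritten as
  -- tensoring with an identity, on which `F` is the identity.
  whiskerLeft x y y' g := ⟨x.1 ◁ g.1, by
    refine (congrArg (fun h => (F.map h).toFun (laxMul F x.2 y.2))
      (id_tensorHom x.1 g.1).symm).trans ((map_laxMul F (𝟙 x.1) g.1 x.2 y.2).trans ?_)
    exact congrArg₂ (laxMul F) (congrArg (fun h => CSet.Hom.toFun h x.2) (F.map_id x.1)) g.2⟩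
  whiskerRight {x x'} f y := ⟨f.1 ▷ y.1, by
    refine (congrArg (fun h => (F.map h).toFun (laxMul F x.2 y.2))
      (tensorHom_id f.1 y.1).symm).trans ((map_laxMul F f.1 (𝟙 y.1) x.2 y.2).trans ?_)
    exact congrArg₂ (laxMul F) f.2 (congrArg (fun h => CSet.Hom.toFun h y.2) (F.map_id y.1))⟩
  tensorUnit := grothMk F (𝟙_ C) (laxUnit F)
  associator x y z := CategoryOfElements.isoMk _ _ (α_ x.1 y.1 z.1)
    (map_associator_laxMul F x.2 y.2 z.2)
  leftUnitor x := CategoryOfElements.isoMk _ _ (λ_ x.1) (map_leftUnitor_laxMul F x.2)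
  rightUnitor x := CategoryOfElements.isoMk _ _ (ρ_ x.1) (map_rightUnitor_laxMul F x.2)

/-- The monoidal structure on `∫ F`. -/
instance grothMonoidal : MonoidalCategory (F ⋙ CSet.forget).Elements :=
  MonoidalCategory.ofTensorHom
    -- The projection is faithful, so every axiom is the corresponding one in the base.
    (id_tensorHom_id := fun x y => CategoryOfElements.ext _ _ _ (id_tensorHom_id x.1 y.1))
    (id_tensorHom := fun x _ _ f => CategoryOfElements.ext _ _ _ (id_tensorHom x.1 f.1))
    (tensorHom_id := fun f x => CategoryOfElements.ext _ _ _ (tensorHom_id f.1 x.1))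
    (tensorHom_comp_tensorHom := fun f₁ f₂ g₁ g₂ => CategoryOfElements.ext _ _ _
      (tensorHom_comp_tensorHom f₁.1 f₂.1 g₁.1 g₂.1))
    (associator_naturality := fun f₁ f₂ f₃ => CategoryOfElements.ext _ _ _
      (associator_naturality f₁.1 f₂.1 f₃.1))
    (leftUnitor_naturality := fun f => CategoryOfElements.ext _ _ _
      ((congrArg (· ≫ _) (id_tensorHom _ f.1)).trans (leftUnitor_naturality f.1)))
    (rightUnitor_naturality := fun f => CategoryOfElements.ext _ _ _
      ((congrArg (· ≫ _) (tensorHom_id f.1 _)).trans (rightUnitor_naturality f.1)))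
    (pentagon := fun w x y z => CategoryOfElements.ext _ _ _ (by
      have h := pentagon w.1 x.1 y.1 z.1
      rw [← tensorHom_id, ← id_tensorHom] at h
      exact h))
    (triangle := fun x y => CategoryOfElements.ext _ _ _ (by
      have h := triangle x.1 y.1
      rw [← tensorHom_id, ← id_tensorHom] at h
      exact h))

/-- The projection from `∫ F` is a strict monoidal functor. -/
def grothCoreMonoidal : (groth F).CoreMonoidal where
  εIso := Iso.refl (𝟙_ C)
  μIso x y := Iso.refl (x.1 ⊗ y.1)
  μIso_hom_natural_left {x y} f z :=
    (Category.comp_id (f.1 ▷ z.1)).trans (Category.id_comp (f.1 ▷ z.1)).symm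
  μIso_hom_natural_right {x y} z f :=
    (Category.comp_id (z.1 ◁ f.1)).trans (Category.id_comp (z.1 ◁ f.1)).symm
  associativity x y z := by
    -- The projection preserves tensor products and the unit on the nose, so all comparison maps are
    -- identities.
    change 𝟙 (x.1 ⊗ y.1) ▷ z.1 ≫ 𝟙 ((x.1 ⊗ y.1) ⊗ z.1) ≫ (α_ x.1 y.1 z.1).hom =
      (α_ x.1 y.1 z.1).hom ≫ x.1 ◁ 𝟙 (y.1 ⊗ z.1) ≫ 𝟙 (x.1 ⊗ y.1 ⊗ z.1)
    simp
  left_unitality x := by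
    change (λ_ x.1).hom = 𝟙 (𝟙_ C) ▷ x.1 ≫ 𝟙 (𝟙_ C ⊗ x.1) ≫ (λ_ x.1).hom
    simp
  right_unitality x := by
    change (ρ_ x.1).hom = x.1 ◁ 𝟙 (𝟙_ C) ≫ 𝟙 (x.1 ⊗ 𝟙_ C) ≫ (ρ_ x.1).hom
    simp

end Monoidal

/-! ### Symmetry and the fibrewise convex monoidal category -/

section Symmetric

variable [MonoidalCategory C] [SymmetricCategory C] [F.LaxBraided]

/-- This is where `F` has to be lax symmetric and not merely lax monoidal: it lifts the braiding of
the base to `∫ F`. -/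
theorem map_braiding_laxMul {c d : C} (x : (F.obj c).carrier) (y : (F.obj d).carrier) :
    (F.map (β_ c d).hom).toFun (laxMul F x y) = laxMul F y x := by
  have h := congrArg (fun φ => φ.toFun (CSet.tmul x y)) (Functor.LaxBraided.braided (F := F) c d)
  exact h.trans (congrArg (μ F d c).toFun (CSet.braid_tmul _ _ x y))

/-- The symmetric monoidal structure on `∫ F`. -/
instance grothSymmetric : SymmetricCategory (F ⋙ CSet.forget).Elements where
  braiding x y := CategoryOfElements.isoMk _ _ (β_ x.1 y.1) (map_braiding_laxMul F x.2 y.2)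
  braiding_naturality_right x _ _ f := CategoryOfElements.ext _ _ _
    (BraidedCategory.braiding_naturality_right x.1 f.1)
  braiding_naturality_left f x := CategoryOfElements.ext _ _ _
    (BraidedCategory.braiding_naturality_left f.1 x.1)
  hexagon_forward x y z := CategoryOfElements.ext _ _ _
    (BraidedCategory.hexagon_forward x.1 y.1 z.1)
  hexagon_reverse x y z := CategoryOfElements.ext _ _ _
    (BraidedCategory.hexagon_reverse x.1 y.1 z.1)
  symmetry x y := CategoryOfElements.ext _ _ _ (SymmetricCategory.symmetry x.1 y.1)

/-- The projection from `∫ F` is a braided functor. -/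
instance grothBraided : (groth F).Braided where
  toMonoidal := (grothCoreMonoidal F).toMonoidal
  braided x y := (Category.id_comp (β_ x.1 y.1).hom).trans (Category.comp_id (β_ x.1 y.1).hom).symm

theorem isStrictMonoidal_groth : IsStrictMonoidal (groth F) where
  obj_unit := rfl
  obj_tensor _ _ := rfl
  ε_eq := rfl
  μ_eq _ _ := rfl

/-- The convex Grothendieck construction of a lax symmetric monoidal functor to convex sets. -/
def grothFibration : ConvexMonoidalFibration (groth F) where
  monoidal := grothMonoidal F
  symmetric := grothSymmetric F
  braided := grothBraided F
  strict := isStrictMonoidal_groth F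
  fibration := isDiscreteFibration_groth F
  convex := grothConvex F
  -- Under the identifications of fibres, tensoring is `laxMul`. Eliminating the equations that
  -- define membership in a fibre makes all casts trivial.
  biconvex c d := isBiconvex_of_equiv (grothFibreEquiv F c) (grothFibreEquiv F d)
    (grothFibreEquiv F (c ⊗ d)) (isBiconvex_laxMul F c d) (by
      rintro ⟨⟨c, x⟩, rfl⟩ ⟨⟨d, y⟩, rfl⟩
      rfl)

theorem grothFibration_isInducedBy :
    (grothFibration F).IsInducedBy (inferInstanceAs F.LaxMonoidal) where
  tensor _ _ _ _ := rfl
  unit := rfl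
  -- By construction `grothFibreMk` is the inverse of the bijection along which the convex structure
  -- was transported.
  fibre c := isAffineMap_equiv_symm (grothFibreEquiv F c)

end Symmetric

end Groth

/-! ### The commutative monoid of twisted distributions -/

/-- The simplex `(k, x)` of `K × X`. -/
def prodPt {n : SimplexCategoryᵒᵖ} (k : K.obj n) (x : X.obj n) : Bun.ProdPt K X n := (k, x)

/-- The first component of a simplex of `K × X`. -/
def coord {n : SimplexCategoryᵒᵖ} (z : Bun.ProdPt K X n) : K.obj n := z.1

@[simp]
theorem coord_prodPt {n : SimplexCategoryᵒᵖ} (k : K.obj n) (x : X.obj n) :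
    coord (prodPt k x) = k := rfl

/-- The value of a distribution on a twisted product, as a distribution on `K n × X n`. -/
def TwistedDist.val {η : TwistingFunction K X} (p : TwistedDist η) {n : SimplexCategoryᵒᵖ}
    (x : X.obj n) : Dist (Bun.ProdPt K X n) := p.eval x

/-- The simplices of `K ×_η X` do not depend on `η`; only a face operator does. Distributions over
propositionally equal twisting functions can thus be compared value by value, without transport. -/
theorem TwistedDist.sigma_ext {z w : Σ η : TwistingFunction K X, TwistedDist η} (h : z.1 = w.1)
    (h' : ∀ (n : SimplexCategoryᵒᵖ) (x : X.obj n),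
      TwistedDist.val z.2 x = TwistedDist.val w.2 x) : z = w := by
  obtain ⟨η, p⟩ := z
  obtain ⟨ζ, q⟩ := w
  obtain rfl : η = ζ := h
  exact congrArg (Sigma.mk η) (SDist.ext h')

variable {η ζ : TwistingFunction K X}

theorem TwistedDist.iConvexComb_congr {Z : Type*} [ConvexSpace ℝ≥0 Z] (p : TwistedDist η)
    {n : SimplexCategoryᵒᵖ} (x : X.obj n) {f g : Bun.ProdPt K X n → Z}
    (h : ∀ k, f (prodPt k x) = g (prodPt k x)) :
    (TwistedDist.val p x).iConvexComb f = (TwistedDist.val p x).iConvexComb g :=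
  SDist.iConvexComb_congr p x fun (e : Bun.ProdPt K X n) (he : e.2 = x) => by
    obtain ⟨k, y⟩ := e
    obtain rfl : y = x := he
    exact h k

/-- Convex combinations along a product of twisted distributions. -/
theorem twistedMul_iConvexComb {Z : Type*} [ConvexSpace ℝ≥0 Z] (p : TwistedDist η)
    (q : TwistedDist ζ) {n : SimplexCategoryᵒᵖ} (x : X.obj n) (g : Bun.ProdPt K X n → Z) :
    (TwistedDist.val (twistedMul p q) x).iConvexComb g =
      (TwistedDist.val p x).iConvexComb fun a => (TwistedDist.val q x).iConvexComb fun b =>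
        g (prodPt (coord a + coord b) x) := by
  refine (iConvexComb_map ((Bun.sDistMul p q).eval x) (Bun.ap (η.mulHom ζ)) g).trans ?_
  -- The comparison map keeps the base point of its first argument, which is `x` wherever `p_x` has
  -- weight.
  exact Bun.sDistMul_iConvexComb p q x
    (b := fun (a b : Bun.ProdPt K X n) => g (prodPt (coord a + coord b) x))
    fun (a b : Bun.ProdPt K X n) _ (ha : a.2 = x) _ =>
      congrArg (fun y => g (prodPt (coord a + coord b) y)) ha

theorem twistedMul_val (p : TwistedDist η) (q : TwistedDist ζ) {n : SimplexCategoryᵒᵖ}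
    (x : X.obj n) : TwistedDist.val (twistedMul p q) x =
      (TwistedDist.val p x).iConvexComb fun a => (TwistedDist.val q x).iConvexComb fun b =>
        StdSimplex.single (prodPt (coord a + coord b) x) :=
  (iConvexComb_single_self _).symm.trans (twistedMul_iConvexComb p q x _)

theorem twistedOne_val {n : SimplexCategoryᵒᵖ} (x : X.obj n) :
    TwistedDist.val (twistedOne K X) x = StdSimplex.single (prodPt 0 x) :=
  StdSimplex.map_single _ _

/-- The product is convolution in the `K`-coordinate: interchanging the sums and commutativity of
`K` suffice. -/
theorem twistedMul_comm (p : TwistedDist η) (q : TwistedDist ζ) :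
    (⟨η + ζ, twistedMul p q⟩ : Σ η : TwistingFunction K X, TwistedDist η) =
      ⟨ζ + η, twistedMul q p⟩ :=
  TwistedDist.sigma_ext (add_comm η ζ) fun n x => by
    dsimp only
    rw [twistedMul_val, twistedMul_val, iConvexComb_comm]
    simp only [add_comm]

theorem twistedMul_assoc {ξ : TwistingFunction K X} (p : TwistedDist η) (q : TwistedDist ζ)
    (r : TwistedDist ξ) :
    (⟨η + ζ + ξ, twistedMul (twistedMul p q) r⟩ : Σ η : TwistingFunction K X, TwistedDist η) =
      ⟨η + (ζ + ξ), twistedMul p (twistedMul q r)⟩ :=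
  TwistedDist.sigma_ext (add_assoc η ζ ξ) fun n x => by
    dsimp only
    rw [twistedMul_val, twistedMul_iConvexComb, twistedMul_val]
    simp only [twistedMul_iConvexComb, coord_prodPt, add_assoc]

theorem twistedOne_mul (p : TwistedDist η) :
    (⟨0 + η, twistedMul (twistedOne K X) p⟩ : Σ η : TwistingFunction K X, TwistedDist η) =
      ⟨η, p⟩ :=
  TwistedDist.sigma_ext (zero_add η) fun n x => by
    dsimp only
    rw [twistedMul_val, twistedOne_val, iConvexComb_single]
    refine Eq.trans ?_ (iConvexComb_single_self _)
    -- The product formula puts `x` in the second coordinate, so it matches a given simplex only on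
    -- the support of `p_x`, where that coordinate is `x`.
    exact TwistedDist.iConvexComb_congr p x fun k =>
      congrArg (fun l => StdSimplex.single (prodPt l x)) (zero_add k)

theorem isBiconvex_twistedMul :
    IsBiconvex (twistedMul : TwistedDist η → TwistedDist ζ → TwistedDist (η + ζ)) :=
  Bun.isBiconvex_sDistMul.comp_affine ((sDist K X).map (η.mulHom ζ)).affine

variable (K X) in
/-- The commutative monoid `∐ η, sDist(π_η)` over the monoid of twisting functions. -/
def twistedDistMonoid :
    FibrewiseBiconvexMonoid (TwistedDist : TwistingFunction K X → Type u) where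
  monoid :=
    { mul := fun z w => ⟨z.1 + w.1, twistedMul z.2 w.2⟩
      one := ⟨0, twistedOne K X⟩
      mul_assoc := fun z w v => twistedMul_assoc z.2 w.2 v.2
      one_mul := fun z => twistedOne_mul z.2
      mul_one := fun z => (twistedMul_comm z.2 (twistedOne K X)).trans (twistedOne_mul z.2)
      mul_comm := fun z w => twistedMul_comm z.2 w.2 }
  fst_one := rfl
  fst_mul _ _ := rfl
  -- The projection of a product is the sum by definition, so the cast in the requirement is the
  -- identity.
  biconvex _ _ := isBiconvex_twistedMul

end ConvexGC

end

/-! ### Assembly of the corollary -/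

theorem mainTheorem10 (K : SimplicialObject AddCommGrpCat.{u}) (X : SSet.{u}) :
    ∃ L : (sDist K X).LaxBraided,
      (∀ (E F : Bun K X) (p : SDist E.proj) (q : SDist F.proj),
        (L.toLaxMonoidal.μ E F).toFun
          (CSet.tmul (A := (sDist K X).obj E) (B := (sDist K X).obj F) p q) =
            Bun.sDistMul p q) ∧
      L.toLaxMonoidal.ε.toFun PUnit.unit = Bun.sDistUnit K X ∧
      (∃ S : ConvexMonoidalFibration (groth (sDist K X)), S.IsInducedBy L.toLaxMonoidal) ∧
      (∃ M : FibrewiseBiconvexMonoid (TwistedDist : TwistingFunction K X → Type u),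
        (∀ (η ζ : TwistingFunction K X) (p : TwistedDist η) (q : TwistedDist ζ),
          M.monoid.mul ⟨η, p⟩ ⟨ζ, q⟩ = ⟨η + ζ, twistedMul p q⟩) ∧
        M.monoid.one = ⟨0, twistedOne K X⟩) := by
  refine ⟨sDistLaxBraided K X, fun E F p q => sDistμ_tmul p q, rfl, ?_,
    twistedDistMonoid K X, fun _ _ _ _ => rfl, rfl⟩
  -- The lax structure just chosen is made the ambient instance, so that the general construction is
  -- induced by this one.
  let := sDistLaxBraided K X
  exact ⟨grothFibration (sDist K X), grothFibration_isInducedBy (sDist K X)⟩
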